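/- All varieties are (integral, separated, finite type) over $\mathbb{C}$; $X_{\mathrm{reg}}$ denotes the smooth locus of $X$, and $\omega$ is called a symplectic form on a smooth variety if it is a closed non-degenerate algebraic $2$-form. A symplectic singularity is a normal variety $X$ with a symplectic form $\omega$ on $X_{\mathrm{reg}}$ such that, for some (equivalently, any) resolution of singularities $f : Z \to X$ (a proper birational morphism from a smooth variety), $f^*\omega$ extends to a regular $2$-form on $Z$. A morphism $\pi : Y \to X$ of normal varieties is a partial resolution if it is projective and birational and restricts to an isomorphism $\pi^{-1}(X_{\mathrm{reg}}) \to X_{\mathrm{reg}}$. Here projective means that $\pi$ factors as a closed immersion $Y \to \mathbb{P}^N_X$ for some $N$ followed by the projection to $X$. If $(X,\omega)$ is a symplectic singularity, the partial resolution $\pi$ is called symplectic if there is a symplectic form on $Y_{\mathrm{reg}}$ that extends the form $\pi^*\omega$ on $\pi^{-1}(X_{\mathrm{reg}})$. The morphism $\pi$ is called crepant if $K_X$ is Cartier and $K_Y = \pi^*K_X$ as divisor classes, that is, if there are canonical divisors $K_X$ on $X$ and $K_Y$ on $Y$ such that $K_X$ is Cartier and $K_Y = \pi^* K_X$. **Theorem.**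 Let $(X,\omega)$ be a symplectic singularity and let $\pi : Y \to X$ be a partial resolution. Then $\pi$ is symplectic if and only if it is crepant. -/

import Mathlib

open CategoryTheory AlgebraicGeometry TopologicalSpace
open scoped KaehlerDifferential

noncomputable section

namespace SymplecticGeometry

/-! ### Algebraic differential forms on `ℂ`-algebras -/

/-- `Ω^p_{A/ℂ}`: the `p`-th exterior power of the Kähler differentials of `A` over `ℂ`. -/
abbrev AlgForm (A : Type) [CommRing A] [Algebra ℂ A] (p : ℕ) : Type :=
  ⋀[A]^p Ω[A⁄ℂ]

/-- The pullback `Ω^p_{A/ℂ} → Ω^p_{B/ℂ}` along a homomorphism of `ℂ`-algebras,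
`a da₁ ∧ … ∧ daₚ ↦ φ(a) dφ(a₁) ∧ … ∧ dφ(aₚ)`. -/
def AlgForm.map {A B : Type} [CommRing A] [Algebra ℂ A] [CommRing B] [Algebra ℂ B]
    (φ : A →ₐ[ℂ] B) (p : ℕ) : AlgForm A p →+ AlgForm B p :=
  letI : Algebra A B := φ.toRingHom.toAlgebra
  haveI : IsScalarTower ℂ A B := IsScalarTower.of_algebraMap_eq fun r => (φ.commutes r).symm
  let wedge : Ω[A⁄ℂ] [⋀^Fin p]→ₗ[A] AlgForm B p :=
    { toMultilinearMap :=
        ((exteriorPower.ιMulti B p (M := Ω[B⁄ℂ])).toMultilinearMap.restrictScalars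
          A).compLinearMap fun _ => KaehlerDifferential.map ℂ ℂ A B
      map_eq_zero_of_eq' := fun _ _ _ h hij =>
        (exteriorPower.ιMulti B p (M := Ω[B⁄ℂ])).map_eq_zero_of_eq _
          (congrArg (KaehlerDifferential.map ℂ ℂ A B) h) hij }
  (exteriorPower.alternatingMapLinearEquiv wedge).toAddMonoidHom

/-- The value `ω(D, E)` of a 2-form on two vector fields (derivations);
`(α ∧ β)(D, E) = α(D) β(E) - α(E) β(D)`. -/
def AlgForm.eval₂ {A : Type} [CommRing A] [Algebra ℂ A] (ω : AlgForm A 2)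
    (D E : Derivation ℂ A A) : A :=
  exteriorPower.pairingDual A Ω[A⁄ℂ] 2
    (exteriorPower.ιMulti A 2 ![D.liftKaehlerDifferential, E.liftKaehlerDifferential]) ω

/-- `dω = 0`, where `dω` is given on vector fields by the invariant formula for the
exterior derivative of a 2-form. -/
def AlgForm.IsClosed {A : Type} [CommRing A] [Algebra ℂ A] (ω : AlgForm A 2) : Prop :=
  ∀ D E F : Derivation ℂ A A,
    D (ω.eval₂ E F) - E (ω.eval₂ D F) + F (ω.eval₂ D E)
      - ω.eval₂ ⁅D, E⁆ F + ω.eval₂ ⁅D, F⁆ E - ω.eval₂ ⁅E, F⁆ D = 0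

/-- A 2-form is non-degenerate if `D ↦ ω(D, ·)` is a bijection from vector fields to
`A`-linear functionals on vector fields (that is, to 1-forms, when `A` is smooth). -/
def AlgForm.IsNondegenerate {A : Type} [CommRing A] [Algebra ℂ A] (ω : AlgForm A 2) : Prop :=
  ∀ l : Derivation ℂ A A →ₗ[A] A, ∃! D : Derivation ℂ A A, ∀ E, ω.eval₂ D E = l E

/-! ### Complex varieties -/

/-- The base scheme `Spec ℂ`. -/
abbrev SpecC : Scheme.{0} := Spec (CommRingCat.of ℂ)

/-- A complex algebraic variety: an integral separated scheme of finite type over `ℂ`. -/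
class IsVariety (X : Scheme.{0}) [X.Over SpecC] : Prop where
  isIntegral : IsIntegral X
  isSeparated : IsSeparated (X ↘ SpecC)
  locallyOfFiniteType : LocallyOfFiniteType (X ↘ SpecC)
  quasiCompact : QuasiCompact (X ↘ SpecC)

attribute [instance] IsVariety.isIntegral IsVariety.isSeparated
  IsVariety.locallyOfFiniteType IsVariety.quasiCompact

instance (X : Scheme.{0}) [X.Over SpecC] [IsVariety X] :
    LocallyOfFinitePresentation (X ↘ SpecC) := by
  have h : LocallyOfFiniteType (X ↘ SpecC) := inferInstance
  rw [HasRingHomProperty.iff_appLE (P := @LocallyOfFiniteType)] at h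
  rw [HasRingHomProperty.iff_appLE (P := @LocallyOfFinitePresentation)]
  intro U V e
  have : IsNoetherianRing Γ(SpecC, U) := IsLocallyNoetherian.component_noetherian U
  exact RingHom.FinitePresentation.of_finiteType.mp (h U V e)

/-- All local rings are integrally closed in their fraction fields. -/
def IsNormalScheme (X : Scheme.{0}) : Prop :=
  ∀ x : X, IsIntegrallyClosed (X.presheaf.stalk x)

/-- `X_reg`: the open set of points at which `X` is smooth over `ℂ`. -/
def regLocus (X : Scheme.{0}) [X.Over SpecC] [IsVariety X] : X.Opens :=
  (X ↘ SpecC).smoothLocus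

lemma le_preimage_top {X Y : Scheme.{0}} (f : X ⟶ Y) (U : X.Opens) : U ≤ f ⁻¹ᵁ ⊤ := by
  rw [Scheme.Hom.preimage_top]
  exact le_top

/-- The `ℂ`-algebra structure on functions on an open set of a `ℂ`-scheme. -/
instance sectionsAlgebra (X : Scheme.{0}) [X.Over SpecC] (U : X.Opens) : Algebra ℂ Γ(X, U) :=
  ((Scheme.ΓSpecIso (CommRingCat.of ℂ)).inv ≫ (X ↘ SpecC).appLE ⊤ U (le_preimage_top _ U)).hom.toAlgebra

/-- The `ℂ`-algebra structure on the local rings (and the function field) of a `ℂ`-scheme. -/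
instance stalkAlgebra (X : Scheme.{0}) [X.Over SpecC] (x : X) :
    Algebra ℂ (X.presheaf.stalk x) :=
  ((X.presheaf.germ ⊤ x (Opens.mem_top x)).hom.comp (algebraMap ℂ Γ(X, ⊤))).toAlgebra

/-- The `ℂ`-algebra structure on the function field. -/
instance functionFieldAlgebra (X : Scheme.{0}) [X.Over SpecC] [IrreducibleSpace X] :
    Algebra ℂ X.functionField :=
  stalkAlgebra X (genericPoint X)

/-- Restriction of functions, as a homomorphism of `ℂ`-algebras. -/
def restrictHom (X : Scheme.{0}) [X.Over SpecC] {U V : X.Opens} (h : V ≤ U) :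
    Γ(X, U) →ₐ[ℂ] Γ(X, V) where
  toRingHom := (X.presheaf.map (homOfLE h).op).hom
  commutes' r := by
    have e := (X ↘ SpecC).appLE_map (U := ⊤) (V := U) (le_preimage_top _ U) (homOfLE h).op
    exact ConcreteCategory.congr_hom e ((Scheme.ΓSpecIso (CommRingCat.of ℂ)).inv r)

/-- Pullback of functions along a morphism of `ℂ`-schemes. -/
def pullbackHom {X Y : Scheme.{0}} [X.Over SpecC] [Y.Over SpecC] (π : Y ⟶ X)
    [π.IsOver SpecC] {U : X.Opens} {V : Y.Opens} (h : V ≤ π ⁻¹ᵁ U) :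
    Γ(X, U) →ₐ[ℂ] Γ(Y, V) where
  toRingHom := (π.appLE U V h).hom
  commutes' r := by
    have e : (X ↘ SpecC).appLE ⊤ U (le_preimage_top _ U) ≫ π.appLE U V h =
        (Y ↘ SpecC).appLE ⊤ V (le_preimage_top _ V) := by
      rw [Scheme.Hom.appLE_comp_appLE]
      simp only [comp_over]
    exact ConcreteCategory.congr_hom e ((Scheme.ΓSpecIso (CommRingCat.of ℂ)).inv r)

/-- The inclusion of a local ring into the function field. -/
def toFunctionField (X : Scheme.{0}) [X.Over SpecC] [IrreducibleSpace X] (x : X) :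
    X.presheaf.stalk x →ₐ[ℂ] X.functionField where
  toRingHom := algebraMap (X.presheaf.stalk x) X.functionField
  commutes' r := by
    have e := X.presheaf.germ_stalkSpecializes (U := ⊤) (Opens.mem_top x)
      ((genericPoint_spec X).specializes trivial)
    exact ConcreteCategory.congr_hom e (algebraMap ℂ Γ(X, ⊤) r)

/-! ### Differential forms on open subsets of a variety -/

/-- A section of `Ω^p_{X/ℂ}` over the open set `U`: a compatible family of elements
of `Ω^p_{Γ(X, V)/ℂ}` for the affine open subsets `V` of `U`. -/
structure DiffForm (X : Scheme.{0}) [X.Over SpecC] (U : X.Opens) (p : ℕ) where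
  val : ∀ V : X.affineOpens, V.1 ≤ U → AlgForm Γ(X, V.1) p
  map_val : ∀ (V W : X.affineOpens) (hV : V.1 ≤ U) (h : W.1 ≤ V.1),
    AlgForm.map (restrictHom X h) p (val V hV) = val W (h.trans hV)

/-- A symplectic form on the open set `U` (meant for `U` smooth): a closed non-degenerate
2-form on `U`. -/
def DiffForm.IsSymplectic {X : Scheme.{0}} [X.Over SpecC] {U : X.Opens}
    (ω : DiffForm X U 2) : Prop :=
  ∀ (V : X.affineOpens) (hV : V.1 ≤ U), (ω.val V hV).IsClosed ∧ (ω.val V hV).IsNondegenerate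

/-- For `π : Y ⟶ X`, a form `ω` on `U ⊆ X` and a form `ω'` on `U' ⊆ Y`: the form `ω'`
agrees with `π^*ω` on `U' ∩ π⁻¹(U)`. If `π⁻¹(U) ⊆ U'`, this says that `ω'` extends `π^*ω`. -/
def DiffForm.ExtendsPullback {X Y : Scheme.{0}} [X.Over SpecC] [Y.Over SpecC] (π : Y ⟶ X)
    [π.IsOver SpecC] {U : X.Opens} {U' : Y.Opens} {p : ℕ}
    (ω : DiffForm X U p) (ω' : DiffForm Y U' p) : Prop :=
  ∀ (V : X.affineOpens) (W : Y.affineOpens) (hV : V.1 ≤ U) (hW : W.1 ≤ U')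
    (h : W.1 ≤ π ⁻¹ᵁ V.1),
    AlgForm.map (pullbackHom π h) p (ω.val V hV) = ω'.val W hW

/-! ### Birational and projective morphisms, resolutions -/

/-- A morphism is birational if it restricts to an isomorphism between dense open subsets of
its source and of its target. -/
class IsBirational {X Y : Scheme.{0}} (π : Y ⟶ X) : Prop where
  exists_partialIso : ∃ e : Y.PartialIso X, e.iso.hom ≫ e.target.ι = e.source.ι ≫ π

instance {X Y : Scheme.{0}} (π : Y ⟶ X) [IsBirational π] : IsDominant π := by
  obtain ⟨e, he⟩ := IsBirational.exists_partialIso (π := π)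
  refine ⟨e.dense_target.mono ?_⟩
  intro x hx
  have h : (e.iso.inv ≫ e.source.ι) ≫ π = e.target.ι := by
    rw [Category.assoc, ← he, Iso.inv_hom_id_assoc]
  let x' : e.target.toScheme := ⟨x, hx⟩
  refine ⟨(e.iso.inv ≫ e.source.ι) x', ?_⟩
  rw [← Scheme.Hom.comp_apply, h]
  rfl

/-- Projective space `ℙ^N` over `ℤ`. -/
def projSpace (N : ℕ) : Scheme.{0} :=
  letI := MvPolynomial.gradedAlgebra (σ := Fin (N + 1)) (R := ℤ)
  Proj (MvPolynomial.homogeneousSubmodule (Fin (N + 1)) ℤ)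

/-- A morphism `Y ⟶ X` is projective if it factors as a closed immersion
into some `ℙ^N_X = X × ℙ^N` followed by the projection to `X`. -/
def IsProjective {X Y : Scheme.{0}} (π : Y ⟶ X) : Prop :=
  ∃ (N : ℕ) (i : Y ⟶ projSpace N), IsClosedImmersion (Limits.prod.lift π i)

/-- `f : Z ⟶ X` is a resolution of singularities: a proper birational morphism from a smooth
variety. -/
structure IsResolution {X Z : Scheme.{0}} [X.Over SpecC] [Z.Over SpecC] (f : Z ⟶ X) : Prop where
  isOver : f.IsOver SpecC
  isVariety : IsVariety Z
  smooth : Smooth (Z ↘ SpecC)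
  proper : IsProper f
  birational : IsBirational f

/-- `(X, ω)` is a symplectic singularity: `X` is a normal variety, `ω` is a symplectic form on
`X_reg`, and `ω` extends to a regular 2-form on a resolution of singularities of `X`. (If this
holds for one resolution, then it holds for every resolution.) -/
structure IsSymplecticSingularity (X : Scheme.{0}) [X.Over SpecC] [IsVariety X]
    (ω : DiffForm X (regLocus X) 2) : Prop where
  normal : IsNormalScheme X
  symplectic : ω.IsSymplectic
  extends_resolution : ∃ (Z : Scheme.{0}) (_ : Z.Over SpecC) (f : Z ⟶ X)
    (_ : f.IsOver SpecC) (ω' : DiffForm Z ⊤ 2),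
    IsResolution f ∧ DiffForm.ExtendsPullback f ω ω'

/-- A partial resolution: a projective birational morphism of normal varieties `π : Y ⟶ X`
which is an isomorphism over `X_reg`. -/
class IsPartialResolution {X Y : Scheme.{0}} [X.Over SpecC] [Y.Over SpecC]
    [IsVariety X] [IsVariety Y] (π : Y ⟶ X) : Prop where
  normal_source : IsNormalScheme Y
  normal_target : IsNormalScheme X
  projective : IsProjective π
  birational : IsBirational π
  isIso_regLocus : IsIso (π ∣_ regLocus X)

attribute [instance] IsPartialResolution.birational

/-- A partial resolution `π : Y ⟶ X` is symplectic, with respect to a symplectic form `ω`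
on `X_reg`, if `ω` extends to a symplectic form on `Y_reg`. -/
def IsSymplecticPartialResolution {X Y : Scheme.{0}} [X.Over SpecC] [Y.Over SpecC]
    [IsVariety X] [IsVariety Y] (π : Y ⟶ X) [π.IsOver SpecC]
    (ω : DiffForm X (regLocus X) 2) : Prop :=
  ∃ ω' : DiffForm Y (regLocus Y) 2, DiffForm.ExtendsPullback π ω ω' ∧ ω'.IsSymplectic

/-! ### Canonical divisors and crepant morphisms -/

/-- A rational form of top degree on a variety: an element of `Ω^n_{K/ℂ}` where `K` is the
function field and `n = dim_K Ω_{K/ℂ}`, which is the dimension of the variety. -/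
abbrev RatTopForm (X : Scheme.{0}) [X.Over SpecC] [IsIntegral X] : Type :=
  AlgForm X.functionField (Module.finrank X.functionField Ω[X.functionField⁄ℂ])

/-- The nonzero rational function `f` is a local equation at `x` of the divisor of the rational
top form `η`: the form `f⁻¹η` generates the `𝒪_{X,x}`-module of top forms regular at `x`
(the image of `Ω^n_{𝒪_{X,x}/ℂ}` in `Ω^n_{K/ℂ}`). At a point `x` of codimension one of a normal
variety this says that `η` and `f` have the same order along the closure of `x`. -/
def IsLocalEquation {X : Scheme.{0}} [X.Over SpecC] [IsIntegral X]
    (η : RatTopForm X) (f : X.functionField) (x : X) : Prop :=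
  f ≠ 0 ∧ ∀ θ : RatTopForm X,
    θ ∈ Set.range (AlgForm.map (toFunctionField X x)
        (Module.finrank X.functionField Ω[X.functionField⁄ℂ])) ↔
      ∃ c : X.presheaf.stalk x, θ = (toFunctionField X x c * f⁻¹) • η

lemma map_genericPoint {X Y : Scheme.{0}} [IrreducibleSpace X] [IrreducibleSpace Y]
    (π : Y ⟶ X) [IsDominant π] : π (genericPoint Y) = genericPoint X := by
  apply ((genericPoint_spec X).eq _).symm
  have h := (genericPoint_spec Y).image π.continuous
  rwa [Set.image_univ, π.denseRange.closure_range] at h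

/-- The field extension `K(X) → K(Y)` given by a dominant morphism `π : Y ⟶ X`. -/
def functionFieldMap {X Y : Scheme.{0}} [IrreducibleSpace X] [IrreducibleSpace Y]
    (π : Y ⟶ X) [IsDominant π] : X.functionField →+* Y.functionField :=
  (π.stalkMap (genericPoint Y)).hom.comp
    (X.presheaf.stalkSpecializes (specializes_of_eq (map_genericPoint π))).hom

/-- A dominant morphism `π : Y ⟶ X` of normal varieties is crepant if `K_X` is Cartier and
`K_Y = π^*K_X` as divisor classes. In detail: there are canonical divisors `K_X = div(η)` and
`K_Y = div(η')`, given by nonzero rational top forms `η`, `η'`, such that at every `p ∈ X` the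
Weil divisor `K_X` has a local equation `f` (valid at all points of codimension one that
specialize to `p`), and the pulled back function `π^*f` is an equation of `K_Y` at
the points `y` of codimension one of `Y` that lie over `p`. -/
def IsCrepant {X Y : Scheme.{0}} [X.Over SpecC] [Y.Over SpecC]
    [IsIntegral X] [IsIntegral Y] (π : Y ⟶ X) [IsDominant π] : Prop :=
  ∃ (η : RatTopForm X) (η' : RatTopForm Y), η ≠ 0 ∧ η' ≠ 0 ∧
    ∀ p : X, ∃ f : X.functionField, f ≠ 0 ∧
      (∀ x : X, Order.coheight x = 1 → x ⤳ p → IsLocalEquation η f x) ∧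
      (∀ y : Y, Order.coheight y = 1 → π y = p →
        IsLocalEquation η' (functionFieldMap π f) y)

end SymplecticGeometry

end

/-! A 2-form `ω` over the function field has an antisymmetric matrix with respect to a basis of
1-forms. Its determinant is a square, so there is a top form `η`, a Pfaffian of `ω`, whose
coordinate squares to that determinant in every basis. Over the local ring of a normal variety at a
smooth point, a regular 2-form is non-degenerate exactly when its Pfaffian generates the regular top
forms (`isNondegenerate_iff_generates_stalk`). Normal varieties are smooth in codimension one, so
this translates non-degeneracy into a statement about canonical divisors.

If `π` is symplectic, the Pfaffians of the forms on `X` and `Y` are rational top forms with trivial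
divisor. They give `K_X = 0` and `K_Y = 0`, and the constant 1 is a local equation everywhere.

Conversely, let `π` be crepant. Since the Pfaffian of `ω` has trivial divisor on `X`, crepancy
yields a rational top form `η'` on `Y` with trivial divisor (`IsCrepant.exists_generates`). The
extension of `ω` to a resolution `Z` makes `π^*ω` regular at each codimension-one point `y` of `Y`:
the local ring there is a discrete valuation ring, and by the valuative criterion its map to `X`
lifts to the proper `Z` (`exists_stalk_of_extendsPullback`). The Pfaffian of `π^*ω` is `π^*k • η'`
for some rational function `k` on `X`. Because `π` is an isomorphism over `X_reg`, which contains
all codimension-one points, `k` is a unit in codimension one, hence a unit at every point of the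
normal variety `X`. So `π^*k` is a unit on all of `Y`, including along exceptional divisors, and
`π^*ω` is non-degenerate in codimension one. Hartogs' principle on the smooth locus of `Y` then
gives a symplectic form there (`exists_isSymplectic_of_forall`), with closedness inherited from the
function field. -/

noncomputable section

namespace SymplecticGeometry

/-! ### Pullback of forms, derivations and localizations. -/

section Forms

variable {A B C : Type} [CommRing A] [Algebra ℂ A] [CommRing B] [Algebra ℂ B]
  [CommRing C] [Algebra ℂ C]

/-- The pullback of 1-forms along a homomorphism of `ℂ`-algebras. -/
def kmap (φ : A →ₐ[ℂ] B) : Ω[A⁄ℂ] →+ Ω[B⁄ℂ] :=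
  letI : Algebra A B := φ.toRingHom.toAlgebra
  haveI : IsScalarTower ℂ A B := IsScalarTower.of_algebraMap_eq fun r => (φ.commutes r).symm
  (KaehlerDifferential.map ℂ ℂ A B).toAddMonoidHom

@[simp]
lemma kmap_D (φ : A →ₐ[ℂ] B) (a : A) :
    kmap φ (KaehlerDifferential.D ℂ A a) = KaehlerDifferential.D ℂ B (φ a) := by
  let : Algebra A B := φ.toRingHom.toAlgebra
  have : IsScalarTower ℂ A B := IsScalarTower.of_algebraMap_eq fun r => (φ.commutes r).symm
  exact KaehlerDifferential.map_D ℂ ℂ A B a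

lemma kmap_smul (φ : A →ₐ[ℂ] B) (a : A) (w : Ω[A⁄ℂ]) : kmap φ (a • w) = φ a • kmap φ w := by
  let : Algebra A B := φ.toRingHom.toAlgebra
  have : IsScalarTower ℂ A B := IsScalarTower.of_algebraMap_eq fun r => (φ.commutes r).symm
  exact (KaehlerDifferential.map ℂ ℂ A B).map_smul a w

lemma form_map_ιMulti (φ : A →ₐ[ℂ] B) {p : ℕ} (v : Fin p → Ω[A⁄ℂ]) :
    AlgForm.map φ p (exteriorPower.ιMulti A p v) = exteriorPower.ιMulti B p fun i => kmap φ (v i) := by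
  let : Algebra A B := φ.toRingHom.toAlgebra
  have : IsScalarTower ℂ A B := IsScalarTower.of_algebraMap_eq fun r => (φ.commutes r).symm
  exact exteriorPower.alternatingMapLinearEquiv_apply_ιMulti _ v

lemma form_map_smul (φ : A →ₐ[ℂ] B) {p : ℕ} (a : A) (w : AlgForm A p) :
    AlgForm.map φ p (a • w) = φ a • AlgForm.map φ p w := by
  let : Algebra A B := φ.toRingHom.toAlgebra
  have : IsScalarTower ℂ A B := IsScalarTower.of_algebraMap_eq fun r => (φ.commutes r).symm
  exact LinearMap.map_smul (exteriorPower.alternatingMapLinearEquiv _) a w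

/-- Induction principle for forms: wedge products, sums, multiples. -/
lemma form_induction {p : ℕ} {P : AlgForm A p → Prop}
    (wedge : ∀ v, P (exteriorPower.ιMulti A p v)) (zero : P 0)
    (add : ∀ x y, P x → P y → P (x + y)) (smul : ∀ (a : A) x, P x → P (a • x))
    (w : AlgForm A p) : P w := by
  have hw : w ∈ Submodule.span A (Set.range (exteriorPower.ιMulti A p (M := Ω[A⁄ℂ]))) := by
    rw [exteriorPower.ιMulti_span]; trivial
  induction hw using Submodule.span_induction with
  | mem x hx => obtain ⟨v, rfl⟩ := hx; exact wedge v
  | zero => exact zero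
  | add x y _ _ hx hy => exact add x y hx hy
  | smul a x _ hx => exact smul a x hx

lemma kaehler_induction {P : Ω[A⁄ℂ] → Prop}
    (d : ∀ a, P (KaehlerDifferential.D ℂ A a)) (zero : P 0)
    (add : ∀ x y, P x → P y → P (x + y)) (smul : ∀ (a : A) x, P x → P (a • x))
    (w : Ω[A⁄ℂ]) : P w := by
  have hw : w ∈ Submodule.span A (Set.range (KaehlerDifferential.D ℂ A)) := by
    rw [KaehlerDifferential.span_range_derivation]; trivial
  induction hw using Submodule.span_induction with
  | mem x hx => obtain ⟨v, rfl⟩ := hx; exact d v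
  | zero => exact zero
  | add x y _ _ hx hy => exact add x y hx hy
  | smul a x _ hx => exact smul a x hx

lemma kmap_comp (φ : A →ₐ[ℂ] B) (ψ : B →ₐ[ℂ] C) (w : Ω[A⁄ℂ]) :
    kmap (ψ.comp φ) w = kmap ψ (kmap φ w) := by
  induction w using kaehler_induction with
  | d a => simp
  | zero => simp
  | add x y hx hy => simp [hx, hy]
  | smul a x hx => simp [kmap_smul, hx]

lemma form_map_comp (φ : A →ₐ[ℂ] B) (ψ : B →ₐ[ℂ] C) {p : ℕ} (w : AlgForm A p) :
    AlgForm.map (ψ.comp φ) p w = AlgForm.map ψ p (AlgForm.map φ p w) := by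
  induction w using form_induction with
  | wedge v => simp only [form_map_ιMulti, kmap_comp]
  | zero => simp
  | add x y hx hy => simp [hx, hy]
  | smul a x hx => simp [form_map_smul, hx]

/-! ### Values of 2-forms on derivations -/

lemma eval₂_wedge (v : Fin 2 → Ω[A⁄ℂ]) (D E : Derivation ℂ A A) :
    AlgForm.eval₂ (exteriorPower.ιMulti A 2 v) D E =
      D.liftKaehlerDifferential (v 0) * E.liftKaehlerDifferential (v 1) -
        E.liftKaehlerDifferential (v 0) * D.liftKaehlerDifferential (v 1) := by
  simp [AlgForm.eval₂, exteriorPower.pairingDual_ιMulti_ιMulti, Matrix.det_fin_two]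

@[simp]
lemma eval₂_add_form (w w' : AlgForm A 2) (D E : Derivation ℂ A A) :
    AlgForm.eval₂ (w + w') D E = w.eval₂ D E + w'.eval₂ D E :=
  map_add _ _ _

@[simp]
lemma eval₂_zero_form (D E : Derivation ℂ A A) : AlgForm.eval₂ (0 : AlgForm A 2) D E = 0 :=
  map_zero _

@[simp]
lemma eval₂_smul_form (a : A) (w : AlgForm A 2) (D E : Derivation ℂ A A) :
    AlgForm.eval₂ (a • w) D E = a * w.eval₂ D E :=
  map_smul _ _ _

lemma lift_add (D D' : Derivation ℂ A A) (w : Ω[A⁄ℂ]) :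
    (D + D').liftKaehlerDifferential w =
      D.liftKaehlerDifferential w + D'.liftKaehlerDifferential w := by
  induction w using kaehler_induction with
  | d a => simp
  | zero => simp
  | add x y hx hy => rw [map_add, map_add, map_add, hx, hy]; ring
  | smul a x hx => rw [map_smul, map_smul, map_smul, hx, smul_add]

lemma lift_smul (r : A) (D : Derivation ℂ A A) (w : Ω[A⁄ℂ]) :
    (r • D).liftKaehlerDifferential w = r * D.liftKaehlerDifferential w := by
  induction w using kaehler_induction with
  | d a => simp
  | zero => simp
  | add x y hx hy => rw [map_add, map_add, hx, hy]; ring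
  | smul a x hx => rw [map_smul, map_smul, hx, smul_eq_mul, smul_eq_mul]; ring

@[simp]
lemma eval₂_add_left (w : AlgForm A 2) (D D' E : Derivation ℂ A A) :
    w.eval₂ (D + D') E = w.eval₂ D E + w.eval₂ D' E := by
  induction w using form_induction with
  | wedge v => simp only [eval₂_wedge, lift_add]; ring
  | zero => simp
  | add x y hx hy => simp only [eval₂_add_form, hx, hy]; ring
  | smul a x hx => simp only [eval₂_smul_form, hx]; ring

lemma eval₂_swap (w : AlgForm A 2) (D E : Derivation ℂ A A) : w.eval₂ D E = -w.eval₂ E D := by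
  induction w using form_induction with
  | wedge v => simp only [eval₂_wedge]; ring
  | zero => simp
  | add x y hx hy => simp only [eval₂_add_form, hx, hy]; ring
  | smul a x hx => simp only [eval₂_smul_form, hx]; ring

@[simp]
lemma eval₂_smul_left (w : AlgForm A 2) (r : A) (D E : Derivation ℂ A A) :
    w.eval₂ (r • D) E = r * w.eval₂ D E := by
  induction w using form_induction with
  | wedge v => simp only [eval₂_wedge, lift_smul]; ring
  | zero => simp
  | add x y hx hy => simp only [eval₂_add_form, hx, hy]; ring
  | smul a x hx => simp only [eval₂_smul_form, hx]; ring

@[simp]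
lemma eval₂_add_right (w : AlgForm A 2) (D E E' : Derivation ℂ A A) :
    w.eval₂ D (E + E') = w.eval₂ D E + w.eval₂ D E' := by
  rw [eval₂_swap, eval₂_add_left, eval₂_swap w E, eval₂_swap w E']; ring

@[simp]
lemma eval₂_smul_right (w : AlgForm A 2) (r : A) (D E : Derivation ℂ A A) :
    w.eval₂ D (r • E) = r * w.eval₂ D E := by
  rw [eval₂_swap, eval₂_smul_left, eval₂_swap w E]; ring

/-- The value of a 2-form on derivations, as a bilinear form. -/
def eval₂Bilin (w : AlgForm A 2) : Derivation ℂ A A →ₗ[A] Derivation ℂ A A →ₗ[A] A :=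
  LinearMap.mk₂ A w.eval₂ (eval₂_add_left w) (eval₂_smul_left w) (eval₂_add_right w)
    (eval₂_smul_right w)

@[simp]
lemma eval₂Bilin_apply (w : AlgForm A 2) (D E : Derivation ℂ A A) :
    eval₂Bilin w D E = w.eval₂ D E := rfl

lemma eval₂_sum_smul_left {ι : Type*} (s : Finset ι) (w : AlgForm A 2) (r : ι → A)
    (D : ι → Derivation ℂ A A) (E : Derivation ℂ A A) :
    w.eval₂ (∑ i ∈ s, r i • D i) E = ∑ i ∈ s, r i * w.eval₂ (D i) E := by
  rw [← eval₂Bilin_apply, map_sum, LinearMap.sum_apply]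
  simp

lemma eval₂_sum_smul_right {ι : Type*} (s : Finset ι) (w : AlgForm A 2) (r : ι → A)
    (D : ι → Derivation ℂ A A) (E : Derivation ℂ A A) :
    w.eval₂ E (∑ i ∈ s, r i • D i) = ∑ i ∈ s, r i * w.eval₂ E (D i) := by
  rw [← eval₂Bilin_apply, map_sum]
  simp

/-! ### Related derivations -/

/-- The derivations `D` of `A` and `D'` of `B` are related by `φ` if `D'` extends `D`. -/
def Related (φ : A →ₐ[ℂ] B) (D : Derivation ℂ A A) (D' : Derivation ℂ B B) : Prop :=
  ∀ a, D' (φ a) = φ (D a)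

lemma Related.lift {φ : A →ₐ[ℂ] B} {D : Derivation ℂ A A} {D' : Derivation ℂ B B}
    (h : Related φ D D') (w : Ω[A⁄ℂ]) :
    D'.liftKaehlerDifferential (kmap φ w) = φ (D.liftKaehlerDifferential w) := by
  induction w using kaehler_induction with
  | d a => simp [h a]
  | zero => simp
  | add x y hx hy => simp only [map_add, hx, hy]
  | smul a x hx => rw [kmap_smul, map_smul, map_smul, hx, smul_eq_mul, smul_eq_mul, map_mul]

/-- Vector fields have no functorial pullback; relatedness replaces it, and this compatibility
carries values of 2-forms between a ring and its localizations. -/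
lemma Related.eval₂ {φ : A →ₐ[ℂ] B} {D E : Derivation ℂ A A} {D' E' : Derivation ℂ B B}
    (hD : Related φ D D') (hE : Related φ E E') (w : AlgForm A 2) :
    (AlgForm.map φ 2 w).eval₂ D' E' = φ (w.eval₂ D E) := by
  induction w using form_induction with
  | wedge v => simp only [form_map_ιMulti, eval₂_wedge, hD.lift, hE.lift, map_sub, map_mul]
  | zero => simp
  | add x y hx hy => simp only [map_add, eval₂_add_form, hx, hy]
  | smul a x hx => rw [form_map_smul, eval₂_smul_form, eval₂_smul_form, hx, map_mul]

lemma Related.bracket {φ : A →ₐ[ℂ] B} {D E : Derivation ℂ A A} {D' E' : Derivation ℂ B B}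
    (hD : Related φ D D') (hE : Related φ E E') : Related φ ⁅D, E⁆ ⁅D', E'⁆ := by
  intro a
  simp only [Derivation.commutator_apply, hD a, hE a, hD (E a), hE (D a), map_sub]

/-! ### Localizations -/

/-- A homomorphism of `ℂ`-algebras that is a localization. -/
def IsLoc (φ : A →ₐ[ℂ] B) : Prop :=
  ∃ M : Submonoid A, @IsLocalization A _ M B _ φ.toRingHom.toAlgebra

lemma IsLoc.surj {φ : A →ₐ[ℂ] B} (h : IsLoc φ) (b : B) :
    ∃ a s : A, IsUnit (φ s) ∧ φ s * b = φ a := by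
  obtain ⟨M, hM⟩ := h
  let : Algebra A B := φ.toRingHom.toAlgebra
  obtain ⟨⟨a, s⟩, e⟩ := IsLocalization.surj (S := B) M b
  exact ⟨a, s, IsLocalization.map_units B s, by rw [mul_comm]; exact e⟩

lemma IsLoc.of_bijective {φ : A →ₐ[ℂ] B} (h : Function.Bijective φ) : IsLoc φ := by
  let : Algebra A B := φ.toRingHom.toAlgebra
  refine ⟨⊥, ?_⟩
  have : IsLocalization (⊥ : Submonoid A) A :=
    IsLocalization.self fun x hx => by rw [Submonoid.mem_bot.mp hx]; exact isUnit_one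
  exact IsLocalization.isLocalization_of_algEquiv ⊥
    (AlgEquiv.ofBijective (Algebra.ofId A B) h)

lemma IsLoc.kaehler_surj {φ : A →ₐ[ℂ] B} (h : IsLoc φ) (w : Ω[B⁄ℂ]) :
    ∃ (s : A) (v : Ω[A⁄ℂ]), IsUnit (φ s) ∧ φ s • w = kmap φ v := by
  obtain ⟨M, hM⟩ := h
  let : Algebra A B := φ.toRingHom.toAlgebra
  have : IsScalarTower ℂ A B := IsScalarTower.of_algebraMap_eq fun r => (φ.commutes r).symm
  obtain ⟨⟨v, s⟩, e⟩ := IsLocalizedModule.surj M (KaehlerDifferential.map ℂ ℂ A B) w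
  exact ⟨s, v, IsLocalization.map_units B s, by
    rw [← show _ = kmap φ v from e]; exact algebraMap_smul B (s : A) w⟩

/-- Kähler differentials commute with localization, so the functional on `Ω[A⁄ℂ]` given by `D`
extends to `Ω[B⁄ℂ]`. -/
lemma IsLoc.exists_related {φ : A →ₐ[ℂ] B} (h : IsLoc φ) (D : Derivation ℂ A A) :
    ∃ D' : Derivation ℂ B B, Related φ D D' := by
  obtain ⟨M, hM⟩ := h
  let : Algebra A B := φ.toRingHom.toAlgebra
  have : IsScalarTower ℂ A B := IsScalarTower.of_algebraMap_eq fun r => (φ.commutes r).symm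
  let f : Ω[A⁄ℂ] →ₗ[A] B := (Algebra.linearMap A B).comp D.liftKaehlerDifferential
  let g : Ω[B⁄ℂ] →ₗ[A] B := IsLocalizedModule.lift M (KaehlerDifferential.map ℂ ℂ A B) f
    (fun x => by
      have := IsLocalization.map_units B x
      rw [Module.End.isUnit_iff]
      have hx : (algebraMap A (Module.End A B) (x : A) : B → B) =
          fun b => algebraMap A B x * b := by
        funext b; simp [Module.algebraMap_end_apply, Algebra.smul_def]
      rw [hx]
      exact (Units.mulLeft_bijective this.unit))
  let g' : Ω[B⁄ℂ] →ₗ[B] B := LinearMap.extendScalarsOfIsLocalization M B g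
  refine ⟨g'.compDer (KaehlerDifferential.D ℂ B), fun a => ?_⟩
  have e : g (KaehlerDifferential.map ℂ ℂ A B (KaehlerDifferential.D ℂ A a)) =
      f (KaehlerDifferential.D ℂ A a) := IsLocalizedModule.lift_apply M _ _ _ _
  rw [KaehlerDifferential.map_D] at e
  simp only [f, LinearMap.comp_apply, Derivation.liftKaehlerDifferential_comp_D] at e
  exact e

/-- The Leibniz rule applied to `s * b = a` determines the derivative of the fraction `b`. -/
lemma IsLoc.derivation_ext {φ : A →ₐ[ℂ] B} (h : IsLoc φ) {D E : Derivation ℂ B B}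
    (hDE : ∀ a, D (φ a) = E (φ a)) : D = E := by
  ext b
  obtain ⟨a, s, hs, e⟩ := h.surj b
  have h1 := congrArg D e
  have h2 := congrArg E e
  rw [Derivation.leibniz, hDE] at h1
  rw [Derivation.leibniz, ← hDE a, ← h1] at h2
  have : φ s • D b = φ s • E b := (add_right_cancel h2).symm
  exact hs.smul_left_cancel.mp this

end Forms

/-! ### Dual systems, non-degeneracy and closedness under localization. -/

section Dual

variable {A B C : Type} [CommRing A] [Algebra ℂ A] [CommRing B] [Algebra ℂ B]
  [CommRing C] [Algebra ℂ C]

/-- A finite dual system of 1-forms and vector fields on `A`, which exhibits `Ω_{A/ℂ}` as a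
finite projective module. -/
structure DualSystem (A : Type) [CommRing A] [Algebra ℂ A] (n : ℕ) where
  form : Fin n → Ω[A⁄ℂ]
  field : Fin n → Derivation ℂ A A
  sum_eq : ∀ w : Ω[A⁄ℂ], ∑ i, (field i).liftKaehlerDifferential w • form i = w

/-- `Ω_{A/ℂ}` is finite projective. -/
def HasDual (A : Type) [CommRing A] [Algebra ℂ A] : Prop :=
  ∃ n, Nonempty (DualSystem A n)

lemma lift_compDer (f : Ω[A⁄ℂ] →ₗ[A] A) (w : Ω[A⁄ℂ]) :
    (f.compDer (KaehlerDifferential.D ℂ A)).liftKaehlerDifferential w = f w := by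
  induction w using kaehler_induction with
  | d a => simp
  | zero => simp
  | add x y hx hy => rw [map_add, map_add, hx, hy]
  | smul a x hx => rw [map_smul, map_smul, hx]

lemma HasDual.of_projective [Module.Finite A Ω[A⁄ℂ]] [Module.Projective A Ω[A⁄ℂ]] :
    HasDual A := by
  obtain ⟨n, f, g, -, -, h⟩ := Module.Finite.exists_comp_eq_id_of_projective A Ω[A⁄ℂ]
  refine ⟨n, ⟨⟨fun i => f (Pi.single i 1), fun i =>
    ((LinearMap.proj i).comp g).compDer (KaehlerDifferential.D ℂ A), fun w => ?_⟩⟩⟩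
  simp only [lift_compDer, LinearMap.comp_apply, LinearMap.proj_apply]
  conv_rhs => rw [← LinearMap.id_apply (R := A) w, ← h, LinearMap.comp_apply,
    ← Finset.univ_sum_single (g w), map_sum]
  refine Finset.sum_congr rfl fun i _ => ?_
  rw [← map_smul, ← Pi.single_smul, smul_eq_mul, mul_one]

namespace DualSystem

variable {n : ℕ}

lemma derivation_eq (d : DualSystem A n) (E : Derivation ℂ A A) :
    E = ∑ i, E.liftKaehlerDifferential (d.form i) • d.field i := by
  ext a
  have h := congrArg E.liftKaehlerDifferential (d.sum_eq (KaehlerDifferential.D ℂ A a))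
  rw [Derivation.liftKaehlerDifferential_comp_D] at h
  rw [← h, map_sum]
  have hs : (∑ i, E.liftKaehlerDifferential (d.form i) • d.field i) a =
      ∑ i, (E.liftKaehlerDifferential (d.form i) • d.field i) a := by
    rw [← Derivation.coeFnAddMonoidHom_apply, map_sum, Finset.sum_apply]; rfl
  rw [hs]
  refine Finset.sum_congr rfl fun i _ => ?_
  rw [map_smul, Derivation.liftKaehlerDifferential_comp_D, smul_eq_mul, mul_comm]
  rfl

/-- The sum runs over ordered pairs, so each wedge is counted twice. As 2 is invertible, a 2-form is
recovered from its values on vector fields. -/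
lemma sum_wedge (d : DualSystem A n) (w : AlgForm A 2) :
    ∑ i, ∑ j, w.eval₂ (d.field i) (d.field j) •
      exteriorPower.ιMulti A 2 ![d.form i, d.form j] = (2 : A) • w := by
  induction w using form_induction with
  | wedge v =>
    have key : ∀ x y : Ω[A⁄ℂ], ∑ i, ∑ j, ((d.field i).liftKaehlerDifferential x *
        (d.field j).liftKaehlerDifferential y) • exteriorPower.ιMulti A 2 ![d.form i, d.form j] =
        exteriorPower.ιMulti A 2 ![x, y] := by
      intro x y
      conv_rhs => rw [← d.sum_eq x, ← d.sum_eq y]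
      have h0 : ∀ u v : Ω[A⁄ℂ], exteriorPower.ιMulti A 2 ![u, v] =
          (exteriorPower.ιMulti A 2 (M := Ω[A⁄ℂ])).toMultilinearMap.curryLeft u ![v] := by
        intro u v; rfl
      have h1 : ∀ u v : Ω[A⁄ℂ], exteriorPower.ιMulti A 2 ![u, v] =
          -exteriorPower.ιMulti A 2 ![v, u] := by
        intro u v
        have := (exteriorPower.ιMulti A 2 (M := Ω[A⁄ℂ])).map_swap ![v, u]
          (i := 0) (j := 1) (by decide)
        rw [← this]
        congr 1
        ext i; fin_cases i <;> rfl
      have hl : ∀ (c : Fin n → A) (u : Fin n → Ω[A⁄ℂ]) (v : Ω[A⁄ℂ]),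
          exteriorPower.ιMulti A 2 ![∑ i, c i • u i, v] =
            ∑ i, c i • exteriorPower.ιMulti A 2 ![u i, v] := by
        intro c u v
        rw [h0, map_sum, sum_apply]
        refine Finset.sum_congr rfl fun i _ => ?_
        rw [map_smul, smul_apply, ← h0]
      rw [hl]
      refine Finset.sum_congr rfl fun i _ => ?_
      rw [h1, hl, ← Finset.sum_neg_distrib, Finset.smul_sum]
      refine Finset.sum_congr rfl fun j _ => ?_
      rw [h1 (d.form j), mul_smul]
      congr 1
      exact (neg_eq_iff_eq_neg.mpr (smul_neg _ _)).symm
    have hv : ![v 0, v 1] = v := by ext i; fin_cases i <;> rfl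
    have hv' : exteriorPower.ιMulti A 2 ![v 1, v 0] = -exteriorPower.ιMulti A 2 v := by
      rw [← (exteriorPower.ιMulti A 2 (M := Ω[A⁄ℂ])).map_swap v (i := 0) (j := 1) (by decide)]
      congr 1
      ext i; fin_cases i <;> rfl
    have hsub : ∀ i j, AlgForm.eval₂ (exteriorPower.ιMulti A 2 v) (d.field i) (d.field j) •
        exteriorPower.ιMulti A 2 ![d.form i, d.form j] =
        ((d.field i).liftKaehlerDifferential (v 0) * (d.field j).liftKaehlerDifferential (v 1)) •
          exteriorPower.ιMulti A 2 ![d.form i, d.form j] -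
        ((d.field i).liftKaehlerDifferential (v 1) * (d.field j).liftKaehlerDifferential (v 0)) •
          exteriorPower.ιMulti A 2 ![d.form i, d.form j] := by
      intro i j
      rw [eval₂_wedge, mul_comm ((d.field j).liftKaehlerDifferential (v 0))]
      exact sub_smul (R := A) (M := AlgForm A 2) _ _ _
    simp only [hsub, Finset.sum_sub_distrib, key]
    rw [hv, hv', sub_neg_eq_add, two_smul]
  | zero => simp
  | add x y hx hy =>
    simp only [eval₂_add_form, add_smul, Finset.sum_add_distrib, hx, hy, smul_add]
  | smul a x hx =>
    simp only [eval₂_smul_form, mul_smul, ← Finset.smul_sum, hx]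
    rw [smul_comm]

end DualSystem

lemma isUnit_two (A : Type) [CommRing A] [Algebra ℂ A] : IsUnit (2 : A) := by
  have : IsUnit (2 : ℂ) := isUnit_iff_ne_zero.mpr two_ne_zero
  have h := this.map (algebraMap ℂ A)
  rwa [map_ofNat] at h

lemma form_ext (hA : HasDual A) {w w' : AlgForm A 2}
    (h : ∀ D E, w.eval₂ D E = w'.eval₂ D E) : w = w' := by
  obtain ⟨n, ⟨d⟩⟩ := hA
  have e := d.sum_wedge w
  simp only [h] at e
  rw [d.sum_wedge] at e
  exact ((isUnit_two A).smul_left_cancel.mp e).symm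

lemma IsLoc.dualSystem {φ : A →ₐ[ℂ] B} (h : IsLoc φ) {n : ℕ} (d : DualSystem A n) :
    ∃ d' : DualSystem B n, (∀ i, d'.form i = kmap φ (d.form i)) ∧
      ∀ i, Related φ (d.field i) (d'.field i) := by
  choose f hf using fun i => h.exists_related (d.field i)
  refine ⟨⟨fun i => kmap φ (d.form i), f, fun w => ?_⟩, fun _ => rfl, hf⟩
  obtain ⟨s, v, hs, e⟩ := h.kaehler_surj w
  refine hs.smul_left_cancel.mp ?_
  rw [Finset.smul_sum]
  simp only [smul_smul]
  have : ∀ i, φ s * (f i).liftKaehlerDifferential w = φ ((d.field i).liftKaehlerDifferential v) := by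
    intro i
    rw [← (hf i).lift, ← e, map_smul, smul_eq_mul]
  simp only [this, ← kmap_smul]
  rw [← map_sum, d.sum_eq, e]

lemma IsLoc.hasDual {φ : A →ₐ[ℂ] B} (h : IsLoc φ) (hA : HasDual A) : HasDual B := by
  obtain ⟨n, ⟨d⟩⟩ := hA
  exact ⟨n, ⟨(h.dualSystem d).choose⟩⟩

lemma IsLoc.form_map_injective {φ : A →ₐ[ℂ] B} (h : IsLoc φ) (hA : HasDual A)
    (hφ : Function.Injective φ) : Function.Injective (AlgForm.map φ 2) := by
  intro w w' e
  refine form_ext hA fun D E => hφ ?_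
  obtain ⟨D', hD⟩ := h.exists_related D
  obtain ⟨E', hE⟩ := h.exists_related E
  rw [← hD.eval₂ hE, e, hD.eval₂ hE]

/-- With a dual system every functional on vector fields comes from a 1-form, and uniqueness of the
solution follows from existence by antisymmetry. Only solvability remains to be checked. -/
lemma isNondegenerate_iff (hA : HasDual A) (w : AlgForm A 2) :
    w.IsNondegenerate ↔ ∀ l : Ω[A⁄ℂ], ∃ D : Derivation ℂ A A, ∀ E,
      w.eval₂ D E = E.liftKaehlerDifferential l := by
  constructor
  · intro h l
    obtain ⟨D, hD, -⟩ := h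
      { toFun := fun E => E.liftKaehlerDifferential l
        map_add' := fun E E' => lift_add E E' l
        map_smul' := fun r E => lift_smul r E l }
    exact ⟨D, hD⟩
  · intro h l
    obtain ⟨n, ⟨d⟩⟩ := hA
    obtain ⟨D, hD⟩ := h (∑ i, l (d.field i) • d.form i)
    have hl : ∀ E, w.eval₂ D E = l E := by
      intro E
      rw [hD, map_sum]
      conv_rhs => rw [d.derivation_eq E, map_sum]
      refine Finset.sum_congr rfl fun i _ => ?_
      rw [map_smul, map_smul, smul_eq_mul, smul_eq_mul, mul_comm]
    -- If `F` represents `da`, then `D a` and `D' a` are both minus the common value of `l` on `F`.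
    refine ⟨D, hl, fun D' hD' => ?_⟩
    ext a
    obtain ⟨F, hF⟩ := h (KaehlerDifferential.D ℂ A a)
    have h1 := hF D'
    have h2 := hF D
    rw [Derivation.liftKaehlerDifferential_comp_D, eval₂_swap, hD'] at h1
    rw [Derivation.liftKaehlerDifferential_comp_D, eval₂_swap, hl] at h2
    rw [← h1, ← h2]

/-- A non-degenerate form determines derivations by their pairing with it. -/
lemma nondegenerate_ext {w : AlgForm A 2} (h : w.IsNondegenerate) {D D' : Derivation ℂ A A}
    (hD : ∀ E, w.eval₂ D E = w.eval₂ D' E) : D = D' :=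
  (h (eval₂Bilin w D')).unique hD fun _ => rfl

lemma eval₂_eq_lift_of_dualSystem {n : ℕ} (d : DualSystem A n) {w : AlgForm A 2}
    {D : Derivation ℂ A A} {l : Ω[A⁄ℂ]}
    (h : ∀ i, w.eval₂ D (d.field i) = (d.field i).liftKaehlerDifferential l)
    (E : Derivation ℂ A A) : w.eval₂ D E = E.liftKaehlerDifferential l := by
  conv_lhs => rw [d.derivation_eq E]
  conv_rhs => rw [← d.sum_eq l]
  rw [eval₂_sum_smul_right, map_sum]
  refine Finset.sum_congr rfl fun i _ => ?_
  rw [h, map_smul, smul_eq_mul, mul_comm]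

/-- Clear the denominator of the 1-form, solve over `A`, extend the solution and divide by the
denominator. -/
lemma IsLoc.isNondegenerate {φ : A →ₐ[ℂ] B} (h : IsLoc φ) (hA : HasDual A) {w : AlgForm A 2}
    (hw : w.IsNondegenerate) : (AlgForm.map φ 2 w).IsNondegenerate := by
  rw [isNondegenerate_iff (h.hasDual hA)]
  rw [isNondegenerate_iff hA] at hw
  intro l
  obtain ⟨s, v, hs, e⟩ := h.kaehler_surj l
  obtain ⟨D, hD⟩ := hw v
  obtain ⟨D', hD'⟩ := h.exists_related D
  obtain ⟨n, ⟨d⟩⟩ := hA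
  obtain ⟨d', hd, hr⟩ := h.dualSystem d
  refine ⟨(↑hs.unit⁻¹ : B) • D', fun E => ?_⟩
  have : (AlgForm.map φ 2 w).eval₂ D' E = φ s * E.liftKaehlerDifferential l := by
    rw [← smul_eq_mul, ← map_smul, e]
    refine eval₂_eq_lift_of_dualSystem d' (fun i => ?_) E
    rw [hD'.eval₂ (hr i), hD, (hr i).lift]
  rw [eval₂_smul_left, this, ← mul_assoc, IsUnit.val_inv_mul, one_mul]

/-! ### Closedness -/

/-- The value of `dω` on three derivations. -/
def extDeriv₂ (w : AlgForm A 2) (D E F : Derivation ℂ A A) : A :=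
  D (w.eval₂ E F) - E (w.eval₂ D F) + F (w.eval₂ D E)
      - w.eval₂ ⁅D, E⁆ F + w.eval₂ ⁅D, F⁆ E - w.eval₂ ⁅E, F⁆ D

lemma isClosed_iff (w : AlgForm A 2) : w.IsClosed ↔ ∀ D E F, extDeriv₂ w D E F = 0 := Iff.rfl

lemma Related.extDeriv₂ {φ : A →ₐ[ℂ] B} {D E F : Derivation ℂ A A} {D' E' F' : Derivation ℂ B B}
    (hD : Related φ D D') (hE : Related φ E E') (hF : Related φ F F') (w : AlgForm A 2) :
    extDeriv₂ (AlgForm.map φ 2 w) D' E' F' = φ (extDeriv₂ w D E F) := by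
  simp only [SymplecticGeometry.extDeriv₂, hE.eval₂ hF, hD.eval₂ hF, hD.eval₂ hE,
    (hD.bracket hE).eval₂ hF, (hD.bracket hF).eval₂ hE, (hE.bracket hF).eval₂ hD, hD _, hE _, hF _,
    map_add, map_sub]

lemma extDeriv₂_swap₁₂ (w : AlgForm A 2) (D E F : Derivation ℂ A A) :
    extDeriv₂ w D E F = -extDeriv₂ w E D F := by
  have h : w.eval₂ ⁅E, D⁆ F = -w.eval₂ ⁅D, E⁆ F := by
    rw [← lie_skew, ← neg_one_smul A, eval₂_smul_left]; ring
  simp only [extDeriv₂, h, eval₂_swap w E D, map_neg]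
  ring

lemma extDeriv₂_swap₂₃ (w : AlgForm A 2) (D E F : Derivation ℂ A A) :
    extDeriv₂ w D E F = -extDeriv₂ w D F E := by
  have h : w.eval₂ ⁅F, E⁆ D = -w.eval₂ ⁅E, F⁆ D := by
    rw [← lie_skew, ← neg_one_smul A, eval₂_smul_left]; ring
  simp only [extDeriv₂, h, eval₂_swap w F E, map_neg]
  ring

lemma extDeriv₂_add_left (w : AlgForm A 2) (D D' E F : Derivation ℂ A A) :
    extDeriv₂ w (D + D') E F = extDeriv₂ w D E F + extDeriv₂ w D' E F := by
  simp only [extDeriv₂, eval₂_add_left, eval₂_add_right, add_lie, Derivation.add_apply, map_add]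
  ring

lemma smul_bracket (r : A) (D E : Derivation ℂ A A) : ⁅r • D, E⁆ = r • ⁅D, E⁆ + (-E r) • D := by
  ext a
  simp only [Derivation.commutator_apply, Derivation.smul_apply, Derivation.add_apply,
    Derivation.leibniz, smul_eq_mul]
  ring

/-- The derivatives of `r` from the Leibniz rule cancel those from the brackets, so `dω` is
tensorial. -/
lemma extDeriv₂_smul_left (w : AlgForm A 2) (r : A) (D E F : Derivation ℂ A A) :
    extDeriv₂ w (r • D) E F = r * extDeriv₂ w D E F := by
  simp only [extDeriv₂, smul_bracket, eval₂_add_left, eval₂_smul_left, eval₂_smul_right,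
    Derivation.leibniz, Derivation.smul_apply, smul_eq_mul, eval₂_swap w ⁅E, F⁆ D]
  ring

lemma extDeriv₂_eq_zero_of_left (w : AlgForm A 2) {n : ℕ} (d : DualSystem A n)
    {E F : Derivation ℂ A A} (h : ∀ i, extDeriv₂ w (d.field i) E F = 0) (D : Derivation ℂ A A) :
    extDeriv₂ w D E F = 0 := by
  have : ∀ D ∈ Submodule.span A (Set.range d.field), extDeriv₂ w D E F = 0 := by
    intro D hD
    induction hD using Submodule.span_induction with
    | mem x hx => obtain ⟨i, rfl⟩ := hx; exact h i
    | zero => simpa using extDeriv₂_smul_left w 0 0 E F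
    | add x y _ _ hx hy => rw [extDeriv₂_add_left, hx, hy, add_zero]
    | smul a x _ hx => rw [extDeriv₂_smul_left, hx, mul_zero]
  refine this D ?_
  rw [d.derivation_eq D]
  exact Submodule.sum_mem _ fun i _ => Submodule.smul_mem _ _ (Submodule.subset_span ⟨i, rfl⟩)

/-- By tensoriality and the sign rules for swaps, each argument in turn can be moved to the front
and reduced to a generating field. -/
lemma isClosed_of_dualSystem (w : AlgForm A 2) {n : ℕ} (d : DualSystem A n)
    (h : ∀ i j k, extDeriv₂ w (d.field i) (d.field j) (d.field k) = 0) : w.IsClosed := by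
  intro D E F
  refine extDeriv₂_eq_zero_of_left w d (fun i => ?_) D
  rw [extDeriv₂_swap₁₂, neg_eq_zero]
  refine extDeriv₂_eq_zero_of_left w d (fun j => ?_) E
  rw [extDeriv₂_swap₂₃, extDeriv₂_swap₁₂, neg_neg]
  refine extDeriv₂_eq_zero_of_left w d (fun k => ?_) F
  exact h k j i

lemma IsLoc.isClosed {φ : A →ₐ[ℂ] B} (h : IsLoc φ) (hA : HasDual A) {w : AlgForm A 2}
    (hw : w.IsClosed) : (AlgForm.map φ 2 w).IsClosed := by
  obtain ⟨n, ⟨d⟩⟩ := hA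
  obtain ⟨d', -, hr⟩ := h.dualSystem d
  refine isClosed_of_dualSystem _ d' fun i j k => ?_
  rw [(hr i).extDeriv₂ (hr j) (hr k), (isClosed_iff w).mp hw, map_zero]

/-- This allows closedness on an integral scheme to be tested at the generic point. -/
lemma IsLoc.isClosed_of_map {φ : A →ₐ[ℂ] B} (h : IsLoc φ) (hφ : Function.Injective φ)
    {w : AlgForm A 2} (hw : (AlgForm.map φ 2 w).IsClosed) : w.IsClosed := by
  intro D E F
  obtain ⟨D', hD⟩ := h.exists_related D
  obtain ⟨E', hE⟩ := h.exists_related E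
  obtain ⟨F', hF⟩ := h.exists_related F
  apply hφ
  rw [map_zero, ← (isClosed_iff _).mp hw D' E' F', hD.extDeriv₂ hE hF]
  rfl

end Dual

/-! ### Linear algebra: antisymmetric determinants and top exterior powers. -/

/-- The determinant of an antisymmetric matrix over a field of characteristic not two is a
square. -/
lemma exists_sq_eq_det_of_transpose_eq_neg {K : Type*} [Field K] (h2 : (2 : K) ≠ 0) (m : ℕ) :
    ∀ {ι : Type} [Fintype ι] [DecidableEq ι] (A : Matrix ι ι K), Fintype.card ι = m →
      A.transpose = -A → ∃ d, A.det = d ^ 2 := by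
  induction m using Nat.strong_induction_on with
  | _ m ih =>
    intro ι _ _ A hm hA
    have hA' : ∀ i j, A j i = -A i j := fun i j => by
      rw [← Matrix.transpose_apply A, hA, Matrix.neg_apply]
    have hdiag : ∀ i, A i i = 0 := fun i => by
      have h := hA' i i
      have : (2 : K) * A i i = 0 := by linear_combination h
      exact (mul_eq_zero.mp this).resolve_left h2
    by_cases h0 : A = 0
    · subst h0
      by_cases hι : Nonempty ι
      · exact ⟨0, by rw [Matrix.det_zero, zero_pow two_ne_zero]⟩
      · have := not_nonempty_iff.mp hι
        exact ⟨1, by rw [Matrix.det_isEmpty, one_pow]⟩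
    obtain ⟨i, j, hij⟩ : ∃ i j, A i j ≠ 0 := by
      by_contra! h
      exact h0 (by ext i j; exact h i j)
    have hne : i ≠ j := fun h => hij (by rw [h, hdiag])
    have h01 : ∀ x : Fin 2, x = 0 ∨ x = 1 := by decide
    -- The indices of a nonzero entry are split off as a leading 2 × 2 block, whose determinant is
    -- `A i j ^ 2`.
    let e : Fin 2 ⊕ {k // k ≠ i ∧ k ≠ j} ≃ ι := Equiv.ofBijective
      (Sum.elim ![i, j] Subtype.val) <| by
        constructor
        · rintro (x | x) (y | y) h
          · rcases h01 x with rfl | rfl <;> rcases h01 y with rfl | rfl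
            exacts [rfl, absurd h hne, absurd h hne.symm, rfl]
          · rcases h01 x with rfl | rfl
            exacts [absurd h.symm y.2.1, absurd h.symm y.2.2]
          · rcases h01 y with rfl | rfl
            exacts [absurd h x.2.1, absurd h x.2.2]
          · exact congrArg Sum.inr (Subtype.ext h)
        · intro k
          by_cases hi : k = i
          · exact ⟨Sum.inl 0, by simp [hi]⟩
          by_cases hj : k = j
          · exact ⟨Sum.inl 1, by simp [hj]⟩
          exact ⟨Sum.inr ⟨k, hi, hj⟩, rfl⟩
    let B := A.submatrix e e
    have hB : B.transpose = -B := by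
      ext x y
      exact hA' (e x) (e y)
    have h11 : B.toBlocks₁₁.transpose = -B.toBlocks₁₁ := by
      ext x y; exact congrFun (congrFun hB _) _
    have h12 : B.toBlocks₁₂.transpose = -B.toBlocks₂₁ := by
      ext x y; exact congrFun (congrFun hB _) _
    have h21 : B.toBlocks₂₁.transpose = -B.toBlocks₁₂ := by
      ext x y; exact congrFun (congrFun hB _) _
    have h22 : B.toBlocks₂₂.transpose = -B.toBlocks₂₂ := by
      ext x y; exact congrFun (congrFun hB _) _
    have hdet : B.toBlocks₁₁.det = A i j ^ 2 := by
      rw [Matrix.det_fin_two]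
      change A i i * A j j - A i j * A j i = _
      rw [hdiag, hA' i j]; ring
    have hu : IsUnit B.toBlocks₁₁.det := by
      rw [hdet]; exact (isUnit_iff_ne_zero.mpr (pow_ne_zero 2 hij))
    let _ : Invertible B.toBlocks₁₁ := Matrix.invertibleOfIsUnitDet _ hu
    have hinv : (B.toBlocks₁₁⁻¹).transpose = -B.toBlocks₁₁⁻¹ := by
      rw [Matrix.transpose_nonsing_inv, h11]
      refine Matrix.inv_eq_left_inv ?_
      rw [neg_mul_neg, Matrix.nonsing_inv_mul _ hu]
    -- The Schur complement of the leading block is again antisymmetric, with two fewer indices.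
    obtain ⟨d, hd⟩ := ih (Fintype.card {k // k ≠ i ∧ k ≠ j}) (by
        rw [← hm, ← Fintype.card_congr e, Fintype.card_sum, Fintype.card_fin]; omega)
      (B.toBlocks₂₂ - B.toBlocks₂₁ * ⅟B.toBlocks₁₁ * B.toBlocks₁₂) rfl (by
        rw [Matrix.invOf_eq_nonsing_inv]
        simp only [Matrix.transpose_sub, Matrix.transpose_mul, h12, h21, h22, hinv]
        simp only [Matrix.neg_mul, Matrix.mul_neg, neg_neg, Matrix.mul_assoc]
        abel)
    refine ⟨A i j * d, ?_⟩
    rw [← Matrix.det_submatrix_equiv_self e A, ← Matrix.fromBlocks_toBlocks (A.submatrix e e),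
      Matrix.det_fromBlocks₁₁, mul_pow, ← hd, ← hdet]

section Top

variable {R M : Type*} [CommRing R] [AddCommGroup M] [Module R M] {n : ℕ}

lemma ιMulti_eq_det_smul (b : Module.Basis (Fin n) R M) (v : Fin n → M) :
    exteriorPower.ιMulti R n v = b.det v • exteriorPower.ιMulti R n b := by
  have : exteriorPower.ιMulti R n (M := M) =
      (LinearMap.toSpanSingleton R (⋀[R]^n M) (exteriorPower.ιMulti R n b)).compAlternatingMap
        b.det := by
    refine Module.Basis.ext_alternating b fun σ hσ => ?_
    let τ : Equiv.Perm (Fin n) := Equiv.ofBijective σ (Finite.injective_iff_bijective.mp hσ)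
    have h1 : (fun i => b (σ i)) = b ∘ τ := rfl
    rw [h1, AlternatingMap.map_perm, LinearMap.compAlternatingMap_apply, AlternatingMap.map_perm,
      Module.Basis.det_self, LinearMap.toSpanSingleton_apply, smul_assoc, one_smul]
  exact congrArg (fun f => f v) this

/-- The coordinate of a top form with respect to a basis. -/
def topCoord (b : Module.Basis (Fin n) R M) : ⋀[R]^n M →ₗ[R] R :=
  exteriorPower.alternatingMapLinearEquiv b.det

@[simp]
lemma topCoord_ιMulti (b : Module.Basis (Fin n) R M) (v : Fin n → M) :
    topCoord b (exteriorPower.ιMulti R n v) = b.det v :=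
  exteriorPower.alternatingMapLinearEquiv_apply_ιMulti _ _

lemma topCoord_smul (b : Module.Basis (Fin n) R M) (w : ⋀[R]^n M) :
    topCoord b w • exteriorPower.ιMulti R n b = w := by
  have hw : w ∈ Submodule.span R (Set.range (exteriorPower.ιMulti R n (M := M))) := by
    rw [exteriorPower.ιMulti_span]; trivial
  induction hw using Submodule.span_induction with
  | mem x hx => obtain ⟨v, rfl⟩ := hx; rw [topCoord_ιMulti, ← ιMulti_eq_det_smul]
  | zero => rw [map_zero, zero_smul]
  | add x y _ _ hx hy => rw [map_add, add_smul, hx, hy]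
  | smul a x _ hx => rw [map_smul, smul_assoc, hx]

lemma topCoord_smul_basis (b : Module.Basis (Fin n) R M) (c : R) :
    topCoord b (c • exteriorPower.ιMulti R n b) = c := by
  rw [map_smul, topCoord_ιMulti, Module.Basis.det_self, smul_eq_mul, mul_one]

end Top

/-! ### Gram matrices and Pfaffians. -/

section Gram

variable {A B : Type} [CommRing A] [Algebra ℂ A] [CommRing B] [Algebra ℂ B] {n : ℕ}

/-- The vector field that is dual to a member of a basis of 1-forms. -/
def coordField (b : Module.Basis (Fin n) A Ω[A⁄ℂ]) (i : Fin n) : Derivation ℂ A A :=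
  (b.coord i).compDer (KaehlerDifferential.D ℂ A)

@[simp]
lemma coordField_lift (b : Module.Basis (Fin n) A Ω[A⁄ℂ]) (i : Fin n) (w : Ω[A⁄ℂ]) :
    (coordField b i).liftKaehlerDifferential w = b.coord i w :=
  lift_compDer _ _

/-- A basis of 1-forms and its dual basis of vector fields. -/
def basisDual (b : Module.Basis (Fin n) A Ω[A⁄ℂ]) : DualSystem A n where
  form := b
  field := coordField b
  sum_eq w := by simp

/-- The matrix of a 2-form with respect to a basis of 1-forms. -/
def gram (b : Module.Basis (Fin n) A Ω[A⁄ℂ]) (w : AlgForm A 2) : Matrix (Fin n) (Fin n) A :=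
  Matrix.of fun i j => w.eval₂ (coordField b i) (coordField b j)

lemma gram_transpose (b : Module.Basis (Fin n) A Ω[A⁄ℂ]) (w : AlgForm A 2) :
    (gram b w).transpose = -gram b w := by
  ext i j
  simp only [gram, Matrix.transpose_apply, Matrix.of_apply, Matrix.neg_apply]
  exact eval₂_swap _ _ _

lemma isNondegenerate_iff_isUnit_det (b : Module.Basis (Fin n) A Ω[A⁄ℂ]) (w : AlgForm A 2) :
    w.IsNondegenerate ↔ IsUnit (gram b w).det := by
  rw [isNondegenerate_iff ⟨n, ⟨basisDual b⟩⟩]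
  constructor
  · intro h
    choose D hD using fun j => h (b j)
    refine Matrix.isUnit_det_of_left_inverse
      (B := Matrix.of fun j i => (D j).liftKaehlerDifferential (b i)) ?_
    ext j k
    have h1 := hD j (coordField b k)
    rw [(basisDual b).derivation_eq (D j), eval₂_sum_smul_left, coordField_lift,
      Module.Basis.coord_apply, Module.Basis.repr_self, Finsupp.single_apply] at h1
    rw [Matrix.mul_apply, Matrix.one_apply]
    exact h1
  · intro h l
    let c : Fin n → A := Matrix.vecMul (fun k => b.coord k l) (gram b w)⁻¹
    refine ⟨∑ i, c i • coordField b i, fun E => ?_⟩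
    have hc : ∀ k, w.eval₂ (∑ i, c i • coordField b i) (coordField b k) = b.coord k l := by
      intro k
      rw [eval₂_sum_smul_left]
      change Matrix.vecMul c (gram b w) k = _
      simp only [c]
      rw [Matrix.vecMul_vecMul, Matrix.nonsing_inv_mul _ h, Matrix.vecMul_one]
    conv_lhs => rw [(basisDual b).derivation_eq E]
    conv_rhs => rw [← b.sum_repr l]
    rw [eval₂_sum_smul_right, map_sum]
    refine Finset.sum_congr rfl fun k _ => ?_
    rw [map_smul, smul_eq_mul, mul_comm]
    congr 1
    exact hc k

/-- Under this congruence the determinant changes by the square of the factor by which the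
coordinate of a top form changes, so the Pfaffian condition does not depend on the basis. -/
lemma gram_change (b b' : Module.Basis (Fin n) A Ω[A⁄ℂ]) (w : AlgForm A 2) :
    gram b w = b.toMatrix b' * gram b' w * (b.toMatrix b').transpose := by
  have h : ∀ i, coordField b i = ∑ j, b.toMatrix b' i j • coordField b' j := by
    intro i
    conv_lhs => rw [(basisDual b').derivation_eq (coordField b i)]
    refine Finset.sum_congr rfl fun j _ => ?_
    rw [coordField_lift]
    rfl
  ext i k
  rw [Matrix.mul_apply, gram, Matrix.of_apply, h i, h k, eval₂_sum_smul_right]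
  refine Finset.sum_congr rfl fun l _ => ?_
  rw [eval₂_sum_smul_left, Matrix.mul_apply, Matrix.transpose_apply, mul_comm]
  rfl

/-- The basis of 1-forms on a localization induced by a basis of 1-forms. -/
lemma IsLoc.exists_basis {φ : A →ₐ[ℂ] B} (h : IsLoc φ) (b : Module.Basis (Fin n) A Ω[A⁄ℂ]) :
    ∃ b' : Module.Basis (Fin n) B Ω[B⁄ℂ], (∀ i, b' i = kmap φ (b i)) ∧
      ∀ i, Related φ (coordField b i) (coordField b' i) := by
  obtain ⟨d, hd, hr⟩ := h.dualSystem (basisDual b)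
  have hdual : ∀ i j, (d.field i).liftKaehlerDifferential (d.form j) = if i = j then 1 else 0 := by
    intro i j
    rw [hd, (hr i).lift]
    simp only [basisDual, coordField_lift, Module.Basis.coord_apply, Module.Basis.repr_self,
      Finsupp.single_apply]
    split_ifs with h1 h2 h2
    · exact map_one φ
    · exact absurd h1.symm h2
    · exact absurd h2.symm h1
    · exact map_zero φ
  let e : Ω[B⁄ℂ] ≃ₗ[B] (Fin n → B) :=
    { toFun := fun w i => (d.field i).liftKaehlerDifferential w
      invFun := fun c => ∑ i, c i • d.form i
      map_add' := fun x y => by ext i; simp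
      map_smul' := fun r x => by ext i; simp
      left_inv := fun w => d.sum_eq w
      right_inv := fun c => by
        ext i
        simp only [map_sum, map_smul, hdual, smul_eq_mul, mul_ite, mul_one, mul_zero]
        simp }
  refine ⟨Module.Basis.ofEquivFun e, fun i => ?_, fun i => ?_⟩
  · rw [← show d.form i = kmap φ (b i) from hd i, Module.Basis.coe_ofEquivFun]
    change ∑ j, (Pi.single i (1 : B) : Fin n → B) j • d.form j = d.form i
    simp [Pi.single_apply, ite_smul]
  · have : coordField (Module.Basis.ofEquivFun e) i = d.field i := by
      ext x
      simp [coordField, e]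
    rw [this]
    exact hr i

/-- `η` is a Pfaffian of the 2-form `w`: if `η = c • b₁ ∧ … ∧ bₙ` then `c²` is the determinant of
the matrix of `w`. -/
def IsPfaffian (η : AlgForm A n) (w : AlgForm A 2) : Prop :=
  ∀ b : Module.Basis (Fin n) A Ω[A⁄ℂ], (gram b w).det = topCoord b η ^ 2

end Gram

/-! ### Generators of the regular top forms over a local ring. -/

section Local

variable {K : Type} [Field K] [Algebra ℂ K] {R : Type} [CommRing R] [Algebra ℂ R] {n : ℕ}

lemma exists_isPfaffian (b : Module.Basis (Fin n) K Ω[K⁄ℂ]) (w : AlgForm K 2) :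
    ∃ η : AlgForm K n, IsPfaffian η w := by
  obtain ⟨d, hd⟩ := exists_sq_eq_det_of_transpose_eq_neg (isUnit_two K).ne_zero n (gram b w)
    (Fintype.card_fin n) (gram_transpose b w)
  refine ⟨d • exteriorPower.ιMulti K n b, fun b' => ?_⟩
  rw [gram_change b' b w, Matrix.det_mul, Matrix.det_mul, Matrix.det_transpose, hd, map_smul,
    topCoord_ιMulti, Module.Basis.det_apply, smul_eq_mul]
  ring

/-- `η` generates the module of top forms that are regular on `R`. -/
def Generates (φ : R →ₐ[ℂ] K) (η : AlgForm K n) : Prop :=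
  ∀ θ : AlgForm K n, θ ∈ Set.range (AlgForm.map φ n) ↔ ∃ c : R, θ = φ c • η

lemma form_map_topCoord {φ : R →ₐ[ℂ] K} (b : Module.Basis (Fin n) R Ω[R⁄ℂ])
    (b' : Module.Basis (Fin n) K Ω[K⁄ℂ]) (hb : ∀ i, b' i = kmap φ (b i)) (w : AlgForm R n) :
    AlgForm.map φ n w = φ (topCoord b w) • exteriorPower.ιMulti K n b' := by
  conv_lhs => rw [← topCoord_smul b w]
  rw [form_map_smul, form_map_ιMulti, show (b' : Fin n → _) = fun i => kmap φ (b i) from funext hb]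

/-- The regular top forms are free of rank one on the wedge of the basis, so generators correspond
to units of `R`. -/
lemma generates_iff {φ : R →ₐ[ℂ] K} (hφ : Function.Injective φ)
    (b : Module.Basis (Fin n) R Ω[R⁄ℂ])
    (b' : Module.Basis (Fin n) K Ω[K⁄ℂ]) (hb : ∀ i, b' i = kmap φ (b i)) (η : AlgForm K n) :
    Generates φ η ↔ ∃ u : R, IsUnit u ∧ topCoord b' η = φ u := by
  have hr : ∀ θ, θ ∈ Set.range (AlgForm.map φ n) ↔
      ∃ c : R, θ = φ c • exteriorPower.ιMulti K n b' := by
    intro θ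
    constructor
    · rintro ⟨w, rfl⟩
      exact ⟨_, form_map_topCoord b b' hb w⟩
    · rintro ⟨c, rfl⟩
      refine ⟨c • exteriorPower.ιMulti R n b, ?_⟩
      rw [form_map_topCoord b b' hb, topCoord_smul_basis]
  constructor
  · intro h
    obtain ⟨u, hu⟩ := (hr η).mp ((h η).mpr ⟨1, by rw [map_one, one_smul]⟩)
    obtain ⟨c, hc⟩ := (h (exteriorPower.ιMulti K n b')).mp
      ((hr _).mpr ⟨1, by rw [map_one, one_smul]⟩)
    refine ⟨u, IsUnit.of_mul_eq_one c (hφ ?_), by rw [hu, topCoord_smul_basis]⟩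
    have := congrArg (topCoord b') hc
    rw [hu, topCoord_ιMulti, Module.Basis.det_self, map_smul, topCoord_smul_basis,
      smul_eq_mul] at this
    rw [map_mul, map_one, this, mul_comm]
  · rintro ⟨u, hu, e⟩ θ
    rw [hr]
    have hη : η = φ u • exteriorPower.ιMulti K n b' := by rw [← e, topCoord_smul]
    constructor
    · rintro ⟨c, rfl⟩
      refine ⟨c * ↑hu.unit⁻¹, ?_⟩
      rw [hη, smul_smul, ← map_mul, mul_assoc, IsUnit.val_inv_mul, mul_one]
    · rintro ⟨c, rfl⟩
      exact ⟨c * u, by rw [hη, smul_smul, map_mul]⟩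

/-- A 2-form over a local ring is nondegenerate if and only if its Pfaffian generates
the top forms. -/
lemma isNondegenerate_iff_generates {φ : R →ₐ[ℂ] K} (hφ : Function.Injective φ) (hl : IsLoc φ)
    (hR : ∀ (x : K) (r : R), x ^ 2 = φ r → ∃ s, x = φ s)
    (b : Module.Basis (Fin n) R Ω[R⁄ℂ]) (w : AlgForm R 2) {η : AlgForm K n}
    (hη : IsPfaffian η (AlgForm.map φ 2 w)) :
    w.IsNondegenerate ↔ Generates φ η := by
  obtain ⟨b', hb, hr⟩ := hl.exists_basis b
  rw [isNondegenerate_iff_isUnit_det b, generates_iff hφ b b' hb]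
  have hg : gram b' (AlgForm.map φ 2 w) = (gram b w).map φ := by
    ext i j
    exact (hr i).eval₂ (hr j) w
  have hdet : φ (gram b w).det = topCoord b' η ^ 2 := by
    rw [← hη b', hg]
    exact RingHom.map_det φ.toRingHom _
  constructor
  · intro hu
    obtain ⟨s, hs⟩ := hR _ _ hdet.symm
    refine ⟨s, ?_, hs⟩
    rw [hs, ← map_pow] at hdet
    rw [hφ hdet] at hu
    exact (isUnit_pow_iff two_ne_zero).mp hu
  · rintro ⟨u, hu, e⟩
    rw [e, ← map_pow] at hdet
    rw [hφ hdet]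
    exact hu.pow 2

lemma Generates.smul_unit {φ : R →ₐ[ℂ] K} {η : AlgForm K n} (h : Generates φ η) {u : R}
    (hu : IsUnit u) : Generates φ (φ u • η) := by
  intro θ
  rw [h]
  constructor
  · rintro ⟨c, rfl⟩
    refine ⟨c * ↑hu.unit⁻¹, ?_⟩
    rw [smul_smul, ← map_mul, mul_assoc, IsUnit.val_inv_mul, mul_one]
  · rintro ⟨c, rfl⟩
    exact ⟨c * u, by rw [smul_smul, map_mul]⟩

/-- Two generators of the same rank-one module differ by a unit; this is how equality of divisors
becomes a statement about functions. -/
lemma Generates.exists_unit {φ : R →ₐ[ℂ] K} (hφ : Function.Injective φ) {η : AlgForm K n}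
    (hη : η ≠ 0) {g : K} (h : Generates φ η) (h' : Generates φ (g • η)) :
    ∃ u : R, IsUnit u ∧ φ u = g := by
  obtain ⟨c, hc⟩ := (h _).mp ((h' (g • η)).mpr ⟨1, by rw [map_one, one_smul]⟩)
  obtain ⟨c', hc'⟩ := (h' _).mp ((h η).mpr ⟨1, by rw [map_one, one_smul]⟩)
  have hg : g = φ c := by
    by_contra hne
    have h0 : (g - φ c) • η = 0 := (sub_smul (M := AlgForm K n) _ _ _).trans (sub_eq_zero.mpr hc)
    have h1 : (g - φ c)⁻¹ • (g - φ c) • η = η := by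
      rw [smul_smul, inv_mul_cancel₀ (sub_ne_zero.mpr hne), one_smul]
    exact hη (by rw [← h1, h0, smul_zero])
  refine ⟨c, IsUnit.of_mul_eq_one c' (hφ ?_), hg.symm⟩
  rw [smul_smul] at hc'
  by_contra hne
  have h0 : (1 - φ c' * g) • η = 0 :=
    (sub_smul (M := AlgForm K n) _ _ _).trans (sub_eq_zero.mpr (by rw [one_smul]; exact hc'))
  have h1 : (1 - φ c' * g) ≠ 0 := fun h => hne (by
    rw [map_mul, map_one, ← hg, mul_comm]; exact (sub_eq_zero.mp h).symm)
  have h2 : (1 - φ c' * g)⁻¹ • (1 - φ c' * g) • η = η := by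
    rw [smul_smul, inv_mul_cancel₀ h1, one_smul]
  exact hη (by rw [← h2, h0, smul_zero])

/-- A finite projective module over a local ring is free, and its rank can be read off over `K`. -/
lemma HasDual.exists_basis [IsLocalRing R] (h : HasDual R) {φ : R →ₐ[ℂ] K} (hl : IsLoc φ) :
    Nonempty (Module.Basis (Fin (Module.finrank K Ω[K⁄ℂ])) R Ω[R⁄ℂ]) := by
  obtain ⟨m, ⟨d⟩⟩ := h
  let f : (Fin m → R) →ₗ[R] Ω[R⁄ℂ] := Fintype.linearCombination R d.form
  let g : Ω[R⁄ℂ] →ₗ[R] (Fin m → R) := LinearMap.pi fun i => (d.field i).liftKaehlerDifferential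
  have hfg : f ∘ₗ g = LinearMap.id := by
    refine LinearMap.ext fun w => ?_
    simpa [f, g, Fintype.linearCombination_apply] using d.sum_eq w
  have : Module.Finite R Ω[R⁄ℂ] := Module.Finite.of_surjective f fun w =>
    ⟨g w, LinearMap.congr_fun hfg w⟩
  have : Module.Projective R Ω[R⁄ℂ] := Module.Projective.of_split g f hfg
  have : Module.Free R Ω[R⁄ℂ] := Module.free_of_flat_of_isLocalRing
  let b := Module.finBasis R Ω[R⁄ℂ]
  obtain ⟨b', -, -⟩ := hl.exists_basis b
  exact ⟨b.reindex (finCongr (by rw [Module.finrank_eq_card_basis b', Fintype.card_fin]))⟩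

end Local

/-! ### Hartogs' principle for functions and for non-degenerate 2-forms. -/

/-- An element of the fraction field of a normal noetherian domain that is regular at all primes of
height one is regular. -/
lemma exists_eq_algebraMap_of_height_one {A K : Type*} [CommRing A] [IsDomain A]
    [IsNoetherianRing A] [IsIntegrallyClosed A] [Field K] [Algebra A K] [IsFractionRing A K] (x : K)
    (h : ∀ q : Ideal A, q.IsPrime → q.height = 1 →
      ∃ s ∉ q, ∃ a, algebraMap A K s * x = algebraMap A K a) :
    ∃ a, x = algebraMap A K a := by
  by_contra hx
  let N : Submodule A K := LinearMap.range (Algebra.linearMap A K)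
  have hN : ∀ y, Submodule.Quotient.mk (p := N) y = 0 ↔ ∃ a, y = algebraMap A K a := by
    intro y
    rw [Submodule.Quotient.mk_eq_zero]
    exact ⟨fun ⟨a, ha⟩ => ⟨a, ha.symm⟩, fun ⟨a, ha⟩ => ⟨a, ha.symm⟩⟩
  have hcol : ∀ (y : K) (r : A), r ∈ (⊥ : Submodule A (K ⧸ N)).colon {Submodule.Quotient.mk y} ↔
      ∃ a, algebraMap A K r * y = algebraMap A K a := by
    intro y r
    rw [Submodule.mem_colon_singleton, Submodule.mem_bot, ← Submodule.Quotient.mk_smul, hN,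
      Algebra.smul_def]
  -- The ideal of denominators of `x` is the annihilator of its class in `K ⧸ A`; it lies in an
  -- associated prime `P`, which turns out to have height one.
  obtain ⟨P, hass, hle⟩ := exists_le_isAssociatedPrime_of_isNoetherianRing A
    (Submodule.Quotient.mk (p := N) x) (fun h => hx ((hN x).mp h))
  rw [isAssociatedPrime_iff] at hass
  obtain ⟨hP, z, hz⟩ := hass
  obtain ⟨y, rfl⟩ := Submodule.Quotient.mk_surjective _ z
  have hPy : ∀ r, r ∈ P ↔ ∃ a, algebraMap A K r * y = algebraMap A K a := by
    intro r; rw [hz, hcol]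
  have hinj := IsFractionRing.injective A K
  have hP0 : P ≠ ⊥ := by
    obtain ⟨⟨a, s⟩, e⟩ := IsLocalization.surj (nonZeroDivisors A) y
    intro h0
    have : (s : A) ∈ P := (hPy _).mpr ⟨a, by rw [mul_comm]; exact e⟩
    rw [h0, Ideal.mem_bot] at this
    exact nonZeroDivisors.ne_zero s.2 this
  have hy : ¬∃ a, y = algebraMap A K a := by
    rintro ⟨a, rfl⟩
    exact hP.ne_top ((Ideal.eq_top_iff_one _).mpr ((hPy 1).mpr ⟨a, by rw [map_one, one_mul]⟩))
  -- Otherwise `y` maps the finitely generated module `P` into itself, so `y` is integral over `A`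
  -- and lies in `A` by normality.
  obtain ⟨t, ht, u, hu, e⟩ : ∃ t ∈ P, ∃ u, u ∉ P ∧ algebraMap A K t * y = algebraMap A K u := by
    by_contra! hall
    have hint : IsIntegral A y := by
      refine isIntegral_of_smul_mem_submodule (M := K) (Submodule.map (Algebra.linearMap A K) P) ?_ ?_ y ?_
      · intro h0
        exact hP0 (Submodule.map_injective_of_injective (f := Algebra.linearMap A K) hinj
          (by rw [h0, Submodule.map_bot]))
      · exact (IsNoetherian.noetherian P).map _
      · rintro _ ⟨r, hr, rfl⟩
        obtain ⟨a, ha⟩ := (hPy r).mp hr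
        refine ⟨a, ?_, ?_⟩
        · by_contra haP
          exact hall r hr a haP ha
        · rw [smul_eq_mul, mul_comm]
          exact ha.symm
    obtain ⟨a, ha⟩ := IsIntegrallyClosed.isIntegral_iff.mp hint
    exact hy ⟨a, ha.symm⟩
  -- For `r ∈ P` with `r * y = a` one has `r * u = t * a`; since `u ∉ P`, any prime inside `P`
  -- containing `t` contains `r`. Krull's principal ideal theorem then bounds the height.
  have hmin : P ∈ (Ideal.span {t}).minimalPrimes := by
    refine ⟨⟨hP, (Ideal.span_singleton_le_iff_mem _).mpr ht⟩, fun Q ⟨hQ, htQ⟩ hQP r hr => ?_⟩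
    obtain ⟨a, ha⟩ := (hPy r).mp hr
    have : r * u = t * a := hinj (by
      rw [map_mul, map_mul, ← e, ← ha]; ring)
    have hmem : r * u ∈ Q := by
      rw [this]
      exact Q.mul_mem_right _ (htQ (Ideal.mem_span_singleton_self t))
    exact (hQ.mem_or_mem hmem).resolve_right fun h => hu (hQP h)
  have hle1 := Ideal.height_le_one_of_isPrincipal_of_mem_minimalPrimes _ P hmin
  have hne0 : P.height ≠ 0 := fun h => hP0 (Ideal.height_eq_zero_iff_eq_bot.mp h)
  obtain ⟨s, hs, a, ha⟩ := h P hP (le_antisymm hle1 (Order.one_le_iff_ne_zero.mpr hne0))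
  exact hs (hle ((hcol x s).mpr ⟨a, ha⟩))

section Extension

variable {K : Type} [Field K] [Algebra ℂ K] {B : Type} [CommRing B] [Algebra ℂ B]

/-- Extensions of a derivation to a localization are unique, so extending in two stages agrees with
extending at once. -/
lemma Related.of_comp {A C : Type} [CommRing A] [Algebra ℂ A] [CommRing C] [Algebra ℂ C]
    {α : A →ₐ[ℂ] B} {β : B →ₐ[ℂ] C} (hβ : IsLoc β) (hc : IsLoc (β.comp α))
    {D : Derivation ℂ A A} {E : Derivation ℂ B B} {F : Derivation ℂ C C}
    (h : Related α D E) (h' : Related (β.comp α) D F) : Related β E F := by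
  obtain ⟨F', hF'⟩ := hβ.exists_related E
  have : F' = F := hc.derivation_ext fun a => by
    rw [h' a, AlgHom.comp_apply, AlgHom.comp_apply, hF', h]
  rwa [← this]

lemma Derivation.exists_of_injective {ψ : B →ₐ[ℂ] K} (hψ : Function.Injective ψ)
    (D : Derivation ℂ K K) (h : ∀ b, D (ψ b) ∈ Set.range ψ) :
    ∃ E : Derivation ℂ B B, Related ψ E D := by
  choose f hf using h
  refine ⟨Derivation.mk' { toFun := f, map_add' := fun x y => hψ ?_, map_smul' := fun r x => hψ ?_ }
    fun x y => hψ ?_, fun b => (hf b).symm⟩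
  · rw [map_add, hf, hf, hf, map_add, map_add]
  · rw [RingHom.id_apply, map_smul, hf, hf, map_smul, D.map_smul]
  · simp only [LinearMap.coe_mk, AddHom.coe_mk, smul_eq_mul]
    rw [map_add, map_mul, map_mul, hf, hf, hf, map_mul, Derivation.leibniz, smul_eq_mul,
      smul_eq_mul]

/-- A 2-form over the fraction field that is regular and non-degenerate over each member of a
family of localizations with intersection `B` is regular and non-degenerate over `B`. -/
lemma exists_nondegenerate_of_forall {ψ : B →ₐ[ℂ] K} (hψ : Function.Injective ψ) (hl : IsLoc ψ)
    (hB : HasDual B) {I : Type} {R : I → Type} [∀ i, CommRing (R i)] [∀ i, Algebra ℂ (R i)]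
    (α : ∀ i, B →ₐ[ℂ] R i) (β : ∀ i, R i →ₐ[ℂ] K) (hαβ : ∀ i, (β i).comp (α i) = ψ)
    (hα : ∀ i, IsLoc (α i)) (hβ : ∀ i, IsLoc (β i))
    (hI : ∀ x : K, (∀ i, x ∈ Set.range (β i)) → x ∈ Set.range ψ) {ω : AlgForm K 2}
    (hω : ω.IsNondegenerate)
    (h : ∀ i, ∃ w : AlgForm (R i) 2, AlgForm.map (β i) 2 w = ω ∧ w.IsNondegenerate) :
    ∃ w : AlgForm B 2, AlgForm.map ψ 2 w = ω ∧ w.IsNondegenerate := by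
  choose v hv hn using h
  obtain ⟨n, ⟨d⟩⟩ := id hB
  obtain ⟨d', hd, hr⟩ := hl.dualSystem d
  have hext : ∀ q (D : Derivation ℂ B B) (D' : Derivation ℂ K K), Related ψ D D' →
      ∃ E, Related (α q) D E ∧ Related (β q) E D' := by
    intro q D D' hD
    obtain ⟨E, hE⟩ := (hα q).exists_related D
    exact ⟨E, hE, hE.of_comp (hβ q) (by rw [hαβ]; exact hl) (by rw [hαβ]; exact hD)⟩
  have hreg : ∀ i j, ω.eval₂ (d'.field i) (d'.field j) ∈ Set.range ψ := by
    intro i j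
    refine hI _ fun q => ?_
    obtain ⟨E, -, hE⟩ := hext q _ _ (hr i)
    obtain ⟨F, -, hF⟩ := hext q _ _ (hr j)
    exact ⟨(v q).eval₂ E F, by rw [← hE.eval₂ hF, hv]⟩
  choose c hc using hreg
  -- The coefficients of `ω` in the dual system lie in every `R i`, hence in `B`; the factor 1/2
  -- undoes the double count of `sum_wedge`.
  let w : AlgForm B 2 := (↑(isUnit_two B).unit⁻¹ : B) • ∑ i, ∑ j, c i j •
      exteriorPower.ιMulti B 2 ![d.form i, d.form j]
  have hw : AlgForm.map ψ 2 w = ω := by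
    refine ((isUnit_two B).map ψ).smul_left_cancel.mp ?_
    rw [← form_map_smul, smul_smul, IsUnit.mul_val_inv, one_smul, map_ofNat, ← d'.sum_wedge]
    simp only [map_sum, form_map_smul, form_map_ιMulti, hc]
    refine Finset.sum_congr rfl fun i _ => Finset.sum_congr rfl fun j _ => ?_
    congr 2
    ext k
    fin_cases k
    · exact (hd i).symm
    · exact (hd j).symm
  refine ⟨w, hw, (isNondegenerate_iff hB w).mpr fun l => ?_⟩
  obtain ⟨D, hD⟩ := (isNondegenerate_iff (hl.hasDual hB) ω).mp hω (kmap ψ l)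
  -- By uniqueness over `K`, the field `D` is the extension of the solution over each `R q`, so it
  -- sends `B` into their intersection.
  have hrange : ∀ b, D (ψ b) ∈ Set.range ψ := by
    intro b
    refine hI _ fun q => ?_
    obtain ⟨E, hE⟩ := (isNondegenerate_iff ((hα q).hasDual hB) (v q)).mp (hn q) (kmap (α q) l)
    obtain ⟨E', hE'⟩ := (hβ q).exists_related E
    have : E' = D := nondegenerate_ext hω fun F => by
      rw [hD]
      refine eval₂_eq_lift_of_dualSystem d' (fun i => ?_) F
      obtain ⟨G, -, hG⟩ := hext q _ _ (hr i)
      rw [← hv q, hE'.eval₂ hG, hE, ← hG.lift, ← kmap_comp, hαβ]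
    refine ⟨E (α q b), ?_⟩
    rw [← hE', this, ← AlgHom.comp_apply, hαβ]
  obtain ⟨E, hE⟩ := Derivation.exists_of_injective hψ D hrange
  refine ⟨E, fun F => hψ ?_⟩
  obtain ⟨F', hF'⟩ := hl.exists_related F
  rw [← hE.eval₂ hF', hw, hD, hF'.lift]

end Extension

/-! ### Smoothness in codimension one: discrete valuation rings in characteristic zero. -/

section DVR

open Polynomial in
/-- A discrete valuation ring that is a localization of a finitely generated algebra over a field
of characteristic zero is formally smooth. -/
lemma formallySmooth_of_isDiscreteValuationRing {k A S : Type} [Field k] [CharZero k] [CommRing A]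
    [Algebra k A] [Algebra.FiniteType k A] [CommRing S] [IsDomain S] [IsDiscreteValuationRing S]
    [Algebra k S] [Algebra A S] [IsScalarTower k A S] (q : Ideal A) [q.IsPrime]
    [IsLocalization.AtPrime S q] : Algebra.FormallySmooth k S := by
  obtain ⟨t₀, ht₀⟩ := IsDiscreteValuationRing.exists_irreducible S
  -- A uniformizer `t` can be taken from `A`. Sending the variable to `t` makes `S` an algebra over
  -- the local ring of the affine line at the origin, to which the fibrewise criterion of smoothness
  -- is applied.
  obtain ⟨⟨t, s⟩, e⟩ := IsLocalization.surj q.primeCompl t₀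
  have hs := IsLocalization.map_units S s
  have ht : Irreducible (algebraMap A S t) := by
    rw [← e]; exact (irreducible_mul_isUnit hs).mpr ht₀
  let φ : k[X] →ₐ[k] A := Polynomial.aeval t
  let _ : Algebra k[X] A := φ.toRingHom.toAlgebra
  have : IsScalarTower k k[X] A := IsScalarTower.of_algebraMap_eq fun r => (φ.commutes r).symm
  let _ : Algebra k[X] S := ((algebraMap A S).comp φ.toRingHom).toAlgebra
  have : IsScalarTower k[X] A S := IsScalarTower.of_algebraMap_eq fun r => rfl
  have : IsScalarTower k k[X] S := IsScalarTower.of_algebraMap_eq fun r => by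
    rw [IsScalarTower.algebraMap_apply k[X] A S, ← IsScalarTower.algebraMap_apply k k[X] A,
      ← IsScalarTower.algebraMap_apply k A S]
  have : Algebra.FiniteType k[X] A := Algebra.FiniteType.of_restrictScalars_finiteType k k[X] A
  have : Algebra.FinitePresentation k[X] A := Algebra.FinitePresentation.of_finiteType.mp this
  have hX : algebraMap k[X] S X = algebraMap A S t := by
    rw [IsScalarTower.algebraMap_apply k[X] A S]
    congr 1
    exact Polynomial.aeval_X t
  let p : Ideal k[X] := Ideal.span {X}
  have hp : p.IsMaximal :=
    PrincipalIdealRing.isMaximal_of_irreducible Polynomial.irreducible_X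
  have hcomap : (IsLocalRing.maximalIdeal S).comap (algebraMap k[X] S) = p := by
    refine (hp.eq_of_le (Ideal.IsPrime.ne_top inferInstance) ?_).symm
    rw [Ideal.span_singleton_le_iff_mem, Ideal.mem_comap, hX, ht.maximalIdeal_eq]
    exact Ideal.mem_span_singleton_self _
  let R := Localization.AtPrime p
  have hunit : ∀ x : k[X], x ∉ p → IsUnit (algebraMap k[X] S x) := by
    intro x hx
    rw [← hcomap, Ideal.mem_comap, IsLocalRing.mem_maximalIdeal, mem_nonunits_iff, not_not] at hx
    exact hx
  let f : R →ₐ[k[X]] S := IsLocalization.liftAlgHom (M := p.primeCompl)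
    (f := Algebra.ofId k[X] S) fun x => hunit x x.2
  algebraize [f.toRingHom]
  have : IsScalarTower k[X] R S := IsScalarTower.of_algebraMap_eq fun r => (f.commutes r).symm
  have : IsScalarTower k R S := .to₁₃₄ _ k[X] _ _
  have hinj : Function.Injective (algebraMap k[X] S) := by
    rw [RingHom.injective_iff_ker_eq_bot]
    -- A nonzero kernel would be maximal and hence contain the variable, forcing `t = 0` in `S`.
    by_contra h0
    have h1 := (RingHom.ker_isPrime (algebraMap k[X] S)).isMaximal h0
    have h2 : RingHom.ker (algebraMap k[X] S) ≤ p := by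
      rw [← hcomap]
      exact Ideal.comap_mono bot_le
    have h3 : X ∈ RingHom.ker (algebraMap k[X] S) := by
      rw [h1.eq_of_le hp.ne_top h2]
      exact Ideal.mem_span_singleton_self _
    exact ht.ne_zero (by rw [← hX]; exact h3)
  have hmk : ∀ (x : k[X]) (s : p.primeCompl), algebraMap R S (IsLocalization.mk' R x s) *
      algebraMap k[X] S s = algebraMap k[X] S x := by
    intro x s
    rw [IsScalarTower.algebraMap_apply k[X] R S, IsScalarTower.algebraMap_apply k[X] R S,
      ← map_mul, IsLocalization.mk'_spec]
  have hinjR : Function.Injective (algebraMap R S) := by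
    rw [injective_iff_map_eq_zero]
    intro r hr
    obtain ⟨x, s, rfl⟩ := IsLocalization.exists_mk'_eq p.primeCompl r
    have h1 := hmk x s
    rw [hr, zero_mul, eq_comm, map_eq_zero_iff _ hinj] at h1
    rw [h1, IsLocalization.mk'_zero]
  have : IsLocalHom (algebraMap R S) := ⟨fun r hr => by
    obtain ⟨x, s, rfl⟩ := IsLocalization.exists_mk'_eq p.primeCompl r
    have h1 : IsUnit (algebraMap k[X] S x) := by
      rw [← hmk x s]
      exact hr.mul (hunit s s.2)
    refine (IsLocalization.AtPrime.isUnit_mk'_iff R p x s).mpr fun hx => ?_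
    change x ∈ p at hx
    rw [← hcomap, Ideal.mem_comap, IsLocalRing.mem_maximalIdeal, mem_nonunits_iff] at hx
    exact hx h1⟩
  -- A faithful domain over a Dedekind domain is torsion-free, hence flat.
  have : IsDedekindDomain R := IsLocalization.isDedekindDomain k[X] p.primeCompl_le_nonZeroDivisors R
  have : FaithfulSMul R S := (faithfulSMul_iff_algebraMap_injective R S).mpr hinjR
  have : Module.Flat R S := inferInstance
  -- The intermediate ring `P` is finitely presented over `R`, and `S` is a localization of it.
  let P := Localization (Algebra.algebraMapSubmonoid A p.primeCompl)
  let g : P →ₐ[A] S := IsLocalization.liftAlgHom (M := Algebra.algebraMapSubmonoid A p.primeCompl)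
        (f := Algebra.ofId _ _) (by
      rintro ⟨_, x, hx, rfl⟩
      change IsUnit (algebraMap A S (algebraMap k[X] A x))
      rw [← IsScalarTower.algebraMap_apply]
      exact hunit x hx)
  algebraize [g.toRingHom]
  have : IsScalarTower A P S := IsScalarTower.of_algebraMap_eq fun r => (g.commutes r).symm
  have : IsScalarTower k[X] P S := .to₁₃₄ _ A _ _
  have : IsScalarTower R P S := .of_algebraMap_eq' <| by
    apply IsLocalization.ringHom_ext p.primeCompl
    simp only [RingHom.comp_assoc, ← IsScalarTower.algebraMap_eq]
  have : IsLocalization (Algebra.algebraMapSubmonoid P q.primeCompl) S :=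
    .isLocalization_of_submonoid_le _ _ (Algebra.algebraMapSubmonoid A p.primeCompl) _
    (by
      rintro _ ⟨x, hx, rfl⟩ hxq
      have h1 : IsUnit (algebraMap A S (algebraMap k[X] A x)) := by
        rw [← IsScalarTower.algebraMap_apply]
        exact hunit x hx
      exact (IsLocalization.AtPrime.isUnit_to_map_iff S q _).mp h1 hxq)
  have : Algebra.FinitePresentation R P := by
    have : Algebra.IsPushout k[X] R A P :=
      .symm <| Algebra.isPushout_of_isLocalization p.primeCompl _ _ _
    exact Algebra.FinitePresentation.equiv (A := TensorProduct k[X] R A)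
      (Algebra.IsPushout.equiv k[X] R A P)
  have : Algebra.EssFiniteType P S :=
    Algebra.EssFiniteType.of_isLocalization _ (Algebra.algebraMapSubmonoid P q.primeCompl)
  have : Algebra.EssFiniteType R S := Algebra.EssFiniteType.comp R P S
  let κ := IsLocalRing.ResidueField R
  let T := TensorProduct R κ S
  have hsurj : Function.Surjective (Algebra.TensorProduct.includeRight : S →ₐ[R] T) := by
    intro x
    induction x with
    | zero => exact ⟨0, map_zero _⟩
    | add x y hx hy =>
      obtain ⟨a, rfl⟩ := hx
      obtain ⟨b, rfl⟩ := hy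
      exact ⟨a + b, map_add _ _ _⟩
    | tmul x y =>
      obtain ⟨r, rfl⟩ := IsLocalRing.residue_surjective x
      refine ⟨r • y, ?_⟩
      rw [Algebra.TensorProduct.includeRight_apply, TensorProduct.tmul_smul,
        TensorProduct.smul_tmul', Algebra.smul_def, mul_one]
      rfl
  have hnt : Nontrivial T :=
    (Algebra.TensorProduct.lift (Algebra.ofId κ (IsLocalRing.ResidueField S))
      (IsScalarTower.toAlgHom R S (IsLocalRing.ResidueField S))
      (fun _ _ => Commute.all _ _)).toRingHom.domain_nontrivial
  have hzero : (Algebra.TensorProduct.includeRight : S →ₐ[R] T) (algebraMap A S t) = 0 := by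
    rw [← hX, IsScalarTower.algebraMap_apply k[X] R S, AlgHom.commutes]
    have : algebraMap R κ (algebraMap k[X] R X) = 0 := by
      rw [IsLocalRing.ResidueField.algebraMap_eq, IsLocalRing.residue_eq_zero_iff]
      exact (IsLocalization.AtPrime.to_map_mem_maximal_iff R p X).mpr
        (Ideal.mem_span_singleton_self _)
    rw [IsScalarTower.algebraMap_apply R κ T, this, map_zero]
  -- The closed fibre `T` is a quotient of `S` in which `t` vanishes, and every non-unit of `S` is a
  -- multiple of `t`. In characteristic zero this field is formally smooth over `κ`.
  have hfield : IsField T := by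
    refine ⟨exists_pair_ne T, mul_comm, fun {x} hx => ?_⟩
    obtain ⟨y, rfl⟩ := hsurj x
    have hy : IsUnit y := by
      by_contra hy
      rw [← mem_nonunits_iff, ← IsLocalRing.mem_maximalIdeal, ht.maximalIdeal_eq,
        Ideal.mem_span_singleton] at hy
      obtain ⟨z, rfl⟩ := hy
      exact hx (by rw [map_mul, hzero, zero_mul])
    obtain ⟨z, hz⟩ := (hy.map (Algebra.TensorProduct.includeRight : S →ₐ[R] T)).exists_right_inv
    exact ⟨z, hz⟩
  have : CharZero κ := charZero_of_injective_algebraMap (algebraMap k κ).injective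
  have : Algebra.FormallySmooth κ T := by
    let _ : Field T := hfield.toField
    exact Algebra.FormallySmooth.of_perfectField
  have h1 : Algebra.FormallySmooth R S :=
    Algebra.FormallySmooth.of_formallySmooth_residueField_tensor (P := P)
      (Algebra.algebraMapSubmonoid P q.primeCompl)
  have : Algebra.FormallyEtale k[X] R := .of_isLocalization p.primeCompl
  have : Algebra.FormallySmooth k R := .comp k k[X] R
  exact .comp k R S

end DVR

/-! ### Points, stalks and function fields of varieties. -/

section Points

lemma exists_primeIdealOf_eq {X : Scheme.{0}} {U : X.Opens} (hU : IsAffineOpen U) (q : PrimeSpectrum Γ(X, U)) :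
    ∃ (x : X) (hx : x ∈ U), hU.primeIdealOf ⟨x, hx⟩ = q := by
  have hq : hU.fromSpec q ∈ U := by
    rw [← SetLike.mem_coe, ← hU.range_fromSpec]
    exact ⟨q, rfl⟩
  exact ⟨hU.fromSpec q, hq, hU.fromSpec.isOpenEmbedding.injective (hU.fromSpec_primeIdealOf _)⟩

lemma mem_of_nonempty {X : Scheme.{0}} [IsIntegral X] {U : X.Opens} (h : (U : Set X).Nonempty) : genericPoint X ∈ U :=
  ((genericPoint_spec X).mem_open_set_iff U.isOpen).mpr (by simpa using h)

lemma exists_affine_mem_le {X : Scheme.{0}} {U : X.Opens} {x : X} (hx : x ∈ U) :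
    ∃ V : X.affineOpens, x ∈ V.1 ∧ V.1 ≤ U := by
  obtain ⟨_, ⟨V, hV, rfl⟩, hxV, hVU⟩ :=
    X.isBasis_affineOpens.exists_subset_of_mem_open hx U.isOpen
  exact ⟨⟨V, hV⟩, hxV, hVU⟩

variable {X : Scheme.{0}} [X.Over SpecC]

/-- The germ of a function at a point, as a homomorphism of `ℂ`-algebras. -/
def germHom (U : X.Opens) (x : X) (hx : x ∈ U) : Γ(X, U) →ₐ[ℂ] X.presheaf.stalk x where
  toRingHom := (X.presheaf.germ U x hx).hom
  commutes' r := by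
    rw [← (restrictHom X (le_top : U ≤ ⊤)).commutes r]
    exact X.presheaf.germ_res_apply (homOfLE le_top) x hx _

lemma germHom_restrict {U V : X.Opens} (h : V ≤ U) (x : X) (hx : x ∈ V) :
    (germHom V x hx).comp (restrictHom X h) = germHom U x (h hx) := by
  ext r
  exact X.presheaf.germ_res_apply (homOfLE h) x hx r

lemma germHom_isLocalization {U : X.Opens} (hU : IsAffineOpen U) (x : X) (hx : x ∈ U) :
    @IsLocalization _ _ (hU.primeIdealOf ⟨x, hx⟩).asIdeal.primeCompl (X.presheaf.stalk x) _
      (germHom U x hx).toRingHom.toAlgebra :=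
  hU.isLocalization_stalk ⟨x, hx⟩

lemma germHom_isLoc {U : X.Opens} (hU : IsAffineOpen U) (x : X) (hx : x ∈ U) :
    IsLoc (germHom U x hx) :=
  ⟨_, germHom_isLocalization hU x hx⟩

lemma isUnit_germHom_iff {U : X.Opens} (hU : IsAffineOpen U) (x : X) (hx : x ∈ U) (a : Γ(X, U)) :
    IsUnit (germHom U x hx a) ↔ a ∉ (hU.primeIdealOf ⟨x, hx⟩).asIdeal := by
  let _ := (germHom U x hx).toRingHom.toAlgebra
  have := germHom_isLocalization hU x hx
  exact IsLocalization.AtPrime.isUnit_to_map_iff _ (hU.primeIdealOf ⟨x, hx⟩).asIdeal a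

/-- The global functions on `Spec ℂ`. -/
def globalC : ℂ ≃+* Γ(SpecC, ⊤) :=
  (Scheme.ΓSpecIso (CommRingCat.of ℂ)).symm.commRingCatIsoToRingEquiv

lemma algebraMap_sections (U : X.Opens) :
    algebraMap ℂ Γ(X, U) =
      ((X ↘ SpecC).appLE ⊤ U (le_preimage_top _ U)).hom.comp globalC.toRingHom := rfl

section Integral

variable [IsIntegral X]

lemma toFunctionField_injective (x : X) : Function.Injective (toFunctionField X x) :=
  IsFractionRing.injective (X.presheaf.stalk x) X.functionField

lemma toFunctionField_isLoc (x : X) : IsLoc (toFunctionField X x) :=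
  ⟨nonZeroDivisors (X.presheaf.stalk x),
    inferInstanceAs (IsFractionRing (X.presheaf.stalk x) X.functionField)⟩

/-- The inclusion of the functions on a nonempty open set into the function field. -/
def germK (U : X.Opens) (hU : genericPoint X ∈ U) : Γ(X, U) →ₐ[ℂ] X.functionField :=
  germHom U (genericPoint X) hU

lemma germK_injective (U : X.Opens) (hU : genericPoint X ∈ U) : Function.Injective (germK U hU) :=
  germ_injective_of_isIntegral _ _ _

lemma germK_isLoc {U : X.Opens} (hU : IsAffineOpen U) (h : genericPoint X ∈ U) :
    IsLoc (germK U h) :=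
  germHom_isLoc hU _ h

lemma toFunctionField_comp_germHom (U : X.Opens) (x : X) (hx : x ∈ U) :
    (toFunctionField X x).comp (germHom U x hx) =
      germK U (mem_of_nonempty ⟨x, hx⟩) := by
  ext r
  exact ConcreteCategory.congr_hom (X.presheaf.germ_stalkSpecializes (U := U) hx
      ((genericPoint_spec X).specializes trivial)) r

lemma germK_restrict {U V : X.Opens} (h : V ≤ U) (hV : genericPoint X ∈ V) :
    (germK V hV).comp (restrictHom X h) = germK U (h hV) :=
  germHom_restrict h _ hV

end Integral

section Variety

variable [IsVariety X]

instance isLocallyNoetherian_of_isVariety : IsLocallyNoetherian X :=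
  LocallyOfFiniteType.isLocallyNoetherian (X ↘ SpecC)

instance finiteType_sections (U : X.affineOpens) : Algebra.FiniteType ℂ Γ(X, U.1) := by
  have h := (HasRingHomProperty.iff_appLE (P := @LocallyOfFiniteType) (f := X ↘ SpecC)).mp
    inferInstance ⟨⊤, isAffineOpen_top _⟩ U (le_preimage_top _ U.1)
  rw [← RingHom.finiteType_algebraMap, algebraMap_sections]
  exact RingHom.FiniteType.comp h (RingHom.FiniteType.of_surjective _ globalC.surjective)

/-- Formal smoothness of a finitely presented algebra can be tested at its primes, and these are the
points of `V`. -/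
lemma smooth_sections (V : X.affineOpens) (hV : V.1 ≤ regLocus X) : Algebra.Smooth ℂ Γ(X, V.1) := by
  have hfp := (X ↘ SpecC).finitePresentation_appLE (isAffineOpen_top _) V.2 (le_preimage_top _ V.1)
  have h : ((X ↘ SpecC).appLE ⊤ V.1 (le_preimage_top _ V.1)).hom.Smooth := by
    algebraize [((X ↘ SpecC).appLE ⊤ V.1 (le_preimage_top _ V.1)).hom]
    have : Algebra.FormallySmooth Γ(SpecC, ⊤) Γ(X, V.1) := by
      rw [← Algebra.smoothLocus_eq_univ_iff, Set.eq_univ_iff_forall]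
      intro q
      obtain ⟨x, hx, rfl⟩ := exists_primeIdealOf_eq V.2 q
      exact (formallySmooth_stalkMap_iff ⊤ (isAffineOpen_top _) V.1 V.2 (le_preimage_top _ V.1)
        hx).mp (Scheme.Hom.mem_smoothLocus.mp (hV hx))
    exact ⟨this, inferInstance⟩
  rw [← RingHom.smooth_algebraMap, algebraMap_sections]
  exact RingHom.Smooth.respectsIso.2 _ globalC h

lemma hasDual_sections (V : X.affineOpens) (hV : V.1 ≤ regLocus X) : HasDual Γ(X, V.1) := by
  have := smooth_sections V hV
  exact HasDual.of_projective

lemma hasDual_stalk {x : X} (hx : x ∈ regLocus X) : HasDual (X.presheaf.stalk x) := by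
  obtain ⟨V, hxV, hV⟩ := exists_affine_mem_le hx
  exact (germHom_isLoc V.2 x hxV).hasDual (hasDual_sections V hV)

lemma genericPoint_mem_regLocus : genericPoint X ∈ regLocus X :=
  Scheme.Hom.genericPoint_mem_smoothLocus_of_perfectField (K := ℂ) (X ↘ SpecC)

/-- The local ring of a normal variety at a point of codimension one is a discrete
valuation ring. -/
lemma isDiscreteValuationRing_stalk (hX : IsNormalScheme X) {x : X} (hx : Order.coheight x = 1) :
    IsDiscreteValuationRing (X.presheaf.stalk x) := by
  have hn : IsIntegrallyClosed (X.presheaf.stalk x) := hX x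
  have hdim : ringKrullDim (X.presheaf.stalk x) = 1 := by
    rw [ringKrullDim_stalk_eq_coheight, hx]; rfl
  have hf : ¬IsField (X.presheaf.stalk x) := fun h => by
    have := ringKrullDim_eq_zero_of_isField h
    rw [hdim] at this
    exact one_ne_zero this
  have : Ring.KrullDimLE 1 (X.presheaf.stalk x) := krullDimLE_of_coheight_le hx.le
  have hD : Ring.DimensionLEOne (X.presheaf.stalk x) :=
    ⟨fun {p} hp0 hp => Ring.krullDimLE_one_iff_of_isPrime_bot.mp this p hp0 hp⟩
  refine ((IsDiscreteValuationRing.TFAE (X.presheaf.stalk x) hf).out 0 2).mpr ?_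
  exact { hn with toDimensionLEOne := hD }

/-- A normal variety is smooth at points of codimension one. -/
lemma mem_regLocus_of_coheight_eq_one (hX : IsNormalScheme X) {x : X}
    (hx : Order.coheight x = 1) : x ∈ regLocus X := by
  obtain ⟨V, hxV, -⟩ := exists_affine_mem_le (U := ⊤) (Opens.mem_top x)
  have := isDiscreteValuationRing_stalk hX hx
  let _ : Algebra Γ(X, V.1) (X.presheaf.stalk x) := (germHom V.1 x hxV).toRingHom.toAlgebra
  have : IsScalarTower ℂ Γ(X, V.1) (X.presheaf.stalk x) :=
    IsScalarTower.of_algebraMap_eq fun r => ((germHom V.1 x hxV).commutes r).symm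
  have := germHom_isLocalization V.2 x hxV
  have h : Algebra.FormallySmooth ℂ (X.presheaf.stalk x) :=
    formallySmooth_of_isDiscreteValuationRing (A := Γ(X, V.1))
      (V.2.primeIdealOf ⟨x, hxV⟩).asIdeal
  refine Scheme.Hom.mem_smoothLocus.mpr ((formallySmooth_stalkMap_iff ⊤ (isAffineOpen_top _) V.1 V.2
    (le_preimage_top _ V.1) hxV).mpr ?_)
  algebraize [((X ↘ SpecC).appLE ⊤ V.1 (le_preimage_top _ V.1)).hom]
  let _ : Algebra ℂ Γ(SpecC, ⊤) := globalC.toRingHom.toAlgebra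
  have : IsScalarTower ℂ Γ(SpecC, ⊤) Γ(X, V.1) := IsScalarTower.of_algebraMap_eq' rfl
  let S := Localization.AtPrime (V.2.primeIdealOf ⟨x, hxV⟩).asIdeal
  have : IsScalarTower ℂ Γ(SpecC, ⊤) S := .to₁₂₄ _ _ Γ(X, V.1) _
  have : Algebra.FormallyEtale ℂ Γ(SpecC, ⊤) :=
    Algebra.FormallyEtale.of_equiv (AlgEquiv.ofBijective (Algebra.ofId ℂ Γ(SpecC, ⊤))
      globalC.bijective)
  have h' : Algebra.FormallySmooth ℂ S := by
    let e := IsLocalization.algEquiv (V.2.primeIdealOf ⟨x, hxV⟩).asIdeal.primeCompl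
      (X.presheaf.stalk x) S
    exact Algebra.FormallySmooth.of_equiv (e.restrictScalars ℂ)
  exact (Algebra.FormallySmooth.iff_restrictScalars (R := ℂ) (A := Γ(SpecC, ⊤))).mp h'

/-- A rational function that is regular in codimension one near a point of a normal variety is
regular at this point. -/
lemma mem_range_toFunctionField (hX : IsNormalScheme X) (p : X) (f : X.functionField)
    (h : ∀ x : X, Order.coheight x = 1 → x ⤳ p → f ∈ Set.range (toFunctionField X x)) :
    f ∈ Set.range (toFunctionField X p) := by
  have : IsIntegrallyClosed (X.presheaf.stalk p) := hX p
  obtain ⟨V, hpV, -⟩ := exists_affine_mem_le (U := ⊤) (Opens.mem_top p)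
  suffices ∃ a, f = algebraMap (X.presheaf.stalk p) X.functionField a by
    obtain ⟨a, ha⟩ := this; exact ⟨a, ha.symm⟩
  refine exists_eq_algebraMap_of_height_one f fun q hq hq1 => ?_
  let _ : Algebra Γ(X, V.1) (X.presheaf.stalk p) := (germHom V.1 p hpV).toRingHom.toAlgebra
  have hloc := germHom_isLocalization V.2 p hpV
  let P := (V.2.primeIdealOf ⟨p, hpV⟩).asIdeal
  let q' : Ideal Γ(X, V.1) := q.comap (algebraMap _ (X.presheaf.stalk p))
  have hq' : q'.height = 1 := by
    rw [← hq1]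
    exact IsLocalization.height_under P.primeCompl q
  obtain ⟨x, hxV, hx⟩ := exists_primeIdealOf_eq V.2 ⟨q', hq.comap _⟩
  have hxq : (V.2.primeIdealOf ⟨x, hxV⟩).asIdeal = q' := congrArg PrimeSpectrum.asIdeal hx
  have hspec : x ⤳ p := by
    -- A function outside the prime of `p` becomes a unit in the local ring at `p`, so it cannot
    -- belong to the contraction of `q`.
    have h1 : V.2.primeIdealOf ⟨x, hxV⟩ ⤳ V.2.primeIdealOf ⟨p, hpV⟩ := by
      rw [← PrimeSpectrum.le_iff_specializes, ← PrimeSpectrum.asIdeal_le_asIdeal, hxq]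
      intro a ha
      by_contra hn
      have hu := (isUnit_germHom_iff V.2 p hpV a).mpr hn
      exact hq.ne_top (Ideal.eq_top_of_isUnit_mem _ ha hu)
    have h2 := h1.map V.2.fromSpec.continuous
    rwa [V.2.fromSpec_primeIdealOf, V.2.fromSpec_primeIdealOf] at h2
  have hco : Order.coheight x = 1 := by
    let _ : Algebra Γ(X, V.1) (X.presheaf.stalk x) := (germHom V.1 x hxV).toRingHom.toAlgebra
    have := germHom_isLocalization V.2 x hxV
    have h1 := IsLocalization.AtPrime.ringKrullDim_eq_height
      (V.2.primeIdealOf ⟨x, hxV⟩).asIdeal (X.presheaf.stalk x)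
    rw [ringKrullDim_stalk_eq_coheight, hxq, hq'] at h1
    exact WithBot.coe_injective h1
  obtain ⟨r, rfl⟩ := h x hco hspec
  obtain ⟨a, s, hs, e⟩ := (germHom_isLoc V.2 x hxV).surj r
  rw [isUnit_germHom_iff V.2, hxq] at hs
  refine ⟨germHom V.1 p hpV s, hs, germHom V.1 p hpV a, ?_⟩
  have e' := congrArg (toFunctionField X x) e
  rw [map_mul] at e'
  have hc := fun r => (DFunLike.congr_fun (toFunctionField_comp_germHom V.1 x hxV) r).trans
    (DFunLike.congr_fun (toFunctionField_comp_germHom V.1 p hpV) r).symm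
  simp only [AlgHom.comp_apply] at hc
  rw [hc, hc] at e'
  exact e'

/-- A rational function that is regular in codimension one on an affine open subset of a normal
variety is regular there. -/
lemma mem_range_germK (hX : IsNormalScheme X) (V : X.affineOpens) (hV : genericPoint X ∈ V.1)
    (f : X.functionField)
    (h : ∀ x ∈ V.1, Order.coheight x = 1 → f ∈ Set.range (toFunctionField X x)) :
    f ∈ Set.range (germK V.1 hV) := by
  -- The ideal of denominators of `f`. If it were proper, a maximal ideal containing it would be a
  -- point where `f` is regular, which supplies a denominator outside that ideal.
  let I : Ideal Γ(X, V.1) :=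
    { carrier := {b | germK V.1 hV b * f ∈ Set.range (germK V.1 hV)}
      zero_mem' := ⟨0, by rw [map_zero, zero_mul]⟩
      add_mem' := by
        rintro a b ⟨a', ha⟩ ⟨b', hb⟩
        exact ⟨a' + b', by rw [map_add, map_add, ha, hb, add_mul]⟩
      smul_mem' := by
        rintro c b ⟨b', hb⟩
        exact ⟨c * b', by rw [smul_eq_mul, map_mul, map_mul, hb, mul_assoc]⟩ }
  by_cases hI : I = ⊤
  · obtain ⟨b, hb⟩ := (Ideal.eq_top_iff_one I).mp hI
    exact ⟨b, by rw [hb, map_one, one_mul]⟩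
  exfalso
  obtain ⟨M, hM, hIM⟩ := Ideal.exists_le_maximal I hI
  obtain ⟨p, hpV, hp⟩ := exists_primeIdealOf_eq V.2 ⟨M, hM.isPrime⟩
  have hpM : (V.2.primeIdealOf ⟨p, hpV⟩).asIdeal = M := congrArg PrimeSpectrum.asIdeal hp
  obtain ⟨r, rfl⟩ := mem_range_toFunctionField hX p f fun x hx hxp =>
    h x (hxp.mem_open V.1.isOpen hpV) hx
  obtain ⟨a, s, hs, e⟩ := (germHom_isLoc V.2 p hpV).surj r
  rw [isUnit_germHom_iff V.2, hpM] at hs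
  refine hs (hIM ⟨a, ?_⟩)
  rw [← toFunctionField_comp_germHom V.1 p hpV, AlgHom.comp_apply, AlgHom.comp_apply, ← e, map_mul]

end Variety

end Points

/-! ### Morphisms and their maps on sections, stalks and function fields. -/

lemma appLE_top {X Y : Scheme.{0}} (f : Y ⟶ X) (h : ⊤ ≤ f ⁻¹ᵁ ⊤) : f.appLE ⊤ ⊤ h = f.appTop :=
  Scheme.Hom.appLE_eq_app f (U := ⊤)

lemma stalkMap_germ_eq {X Y : Scheme.{0}} (π : Y ⟶ X) {U : X.Opens} {V : Y.Opens}
    (h : V ≤ π ⁻¹ᵁ U) (y : Y) (hy : y ∈ V) (r : Γ(X, U)) :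
    π.stalkMap y (X.presheaf.germ U (π y) (h hy) r) = Y.presheaf.germ V y hy (π.appLE U V h r) :=
  (Scheme.Hom.germ_stalkMap_apply π U y (h hy) r).trans
    (Y.presheaf.germ_res_apply (homOfLE h) y hy _).symm

lemma exists_apply_eq {X Y : Scheme.{0}} (π : Y ⟶ X) (U : X.Opens) [IsIso (π ∣_ U)] (x : X)
    (hx : x ∈ U) : ∃ y, π y = x := by
  let x' : U.toScheme := ⟨x, hx⟩
  have h : (π ∣_ U) ((inv (π ∣_ U)) x') = x' := by
    rw [← Scheme.Hom.comp_apply, IsIso.inv_hom_id]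
    rfl
  exact ⟨((inv (π ∣_ U)) x').1,
    (morphismRestrict_base_coe π U _).symm.trans (congrArg Subtype.val h)⟩

lemma fromSpecStalk_appLE {X : Scheme.{0}} (x : X) {U : X.Opens} (hx : x ∈ U)
    (hU : ⊤ ≤ (X.fromSpecStalk x) ⁻¹ᵁ U) :
    (X.fromSpecStalk x).appLE U ⊤ hU ≫ (Scheme.ΓSpecIso (X.presheaf.stalk x)).hom =
      X.presheaf.germ U x hx := by
  rw [Scheme.Hom.appLE, Scheme.fromSpecStalk_app hx, Category.assoc, Category.assoc,
    Category.assoc, ← Functor.map_comp_assoc]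
  have h : (homOfLE (le_top (a := X.fromSpecStalk x ⁻¹ᵁ U))).op ≫ (homOfLE hU).op =
      𝟙 (Opposite.op ⊤) := rfl
  rw [h, CategoryTheory.Functor.map_id, Category.id_comp, Iso.inv_hom_id, Category.comp_id]

section Morphisms

variable {X Y : Scheme.{0}} [X.Over SpecC] [Y.Over SpecC] (π : Y ⟶ X) [π.IsOver SpecC]

/-- The homomorphism of local rings induced by a morphism of `ℂ`-schemes. -/
def stalkHom (y : Y) : X.presheaf.stalk (π y) →ₐ[ℂ] Y.presheaf.stalk y where
  toRingHom := (π.stalkMap y).hom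
  commutes' r := by
    have e := (pullbackHom π (U := ⊤) (V := ⊤) (le_preimage_top _ _)).commutes r
    refine (stalkMap_germ_eq π (U := ⊤) (V := ⊤) (le_preimage_top _ _) y (Opens.mem_top y)
      (algebraMap ℂ Γ(X, ⊤) r)).trans ?_
    exact congrArg (Y.presheaf.germ ⊤ y (Opens.mem_top y)) e

lemma stalkHom_comp_germHom {U : X.Opens} {V : Y.Opens} (h : V ≤ π ⁻¹ᵁ U) (y : Y) (hy : y ∈ V) :
    (stalkHom π y).comp (germHom U (π y) (h hy)) = (germHom V y hy).comp (pullbackHom π h) := by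
  ext r
  exact stalkMap_germ_eq π h y hy r

lemma stalkHom_bijective (U : X.Opens) [IsIso (π ∣_ U)] (y : Y) (hy : π y ∈ U) :
    Function.Bijective (stalkHom π y) := by
  let y' : (π ⁻¹ᵁ U).toScheme := ⟨y, hy⟩
  have h : IsIso ((π ∣_ U).stalkMap y') := inferInstance
  have : IsIso (π.stalkMap y) :=
    (((MorphismProperty.isomorphisms CommRingCat).arrow_mk_iso_iff
      (morphismRestrictStalkMap π U y')).mp h)
  exact ConcreteCategory.bijective_of_isIso (π.stalkMap y)

section Dominant

variable [IsIntegral X] [IsIntegral Y] [IsDominant π]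

/-- The extension of function fields given by a dominant morphism of `ℂ`-schemes. -/
def ffHom : X.functionField →ₐ[ℂ] Y.functionField where
  toRingHom := functionFieldMap π
  commutes' r := by
    rw [← (stalkHom π (genericPoint Y)).commutes r]
    have : X.presheaf.stalkSpecializes (specializes_of_eq (map_genericPoint π))
        (algebraMap ℂ X.functionField r) = algebraMap ℂ (X.presheaf.stalk (π (genericPoint Y))) r :=
      X.presheaf.germ_stalkSpecializes_apply (U := ⊤) (Opens.mem_top _)
        (specializes_of_eq (map_genericPoint π)) (algebraMap ℂ Γ(X, ⊤) r)
    exact congrArg (π.stalkMap (genericPoint Y)).hom this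

lemma ffHom_comp_toFunctionField (y : Y) :
    (ffHom π).comp (toFunctionField X (π y)) = (toFunctionField Y y).comp (stalkHom π y) := by
  ext r
  have hy : genericPoint Y ⤳ y := (genericPoint_spec Y).specializes trivial
  refine Eq.trans ?_ (Scheme.Hom.stalkSpecializes_stalkMap_apply π _ _ hy r)
  refine congrArg (π.stalkMap (genericPoint Y)).hom ?_
  exact ConcreteCategory.congr_hom (X.presheaf.stalkSpecializes_comp
    (specializes_of_eq (map_genericPoint π)) ((genericPoint_spec X).specializes trivial)) r

lemma ffHom_comp_germK {U : X.Opens} {V : Y.Opens} (h : V ≤ π ⁻¹ᵁ U) (hU : genericPoint X ∈ U)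
    (hV : genericPoint Y ∈ V) :
    (ffHom π).comp (germK U hU) = (germK V hV).comp (pullbackHom π h) := by
  rw [germK, germK, ← stalkHom_comp_germHom π h _ hV]
  ext r
  refine congrArg (π.stalkMap (genericPoint Y)).hom ?_
  exact X.presheaf.germ_stalkSpecializes_apply (U := U) _
    (specializes_of_eq (map_genericPoint π)) r

lemma ffHom_bijective (U : X.Opens) [IsIso (π ∣_ U)] (hU : genericPoint X ∈ U) :
    Function.Bijective (ffHom π) := by
  have h1 := stalkHom_bijective π U (genericPoint Y) (by rwa [map_genericPoint π])
  refine h1.comp ?_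
  exact ConcreteCategory.bijective_of_isIso
    (X.presheaf.stalkCongr (Inseparable.of_eq (map_genericPoint π).symm)).hom

end Dominant

/-! ### Points with values in `ℂ`-algebras -/

/-- A morphism `Spec R ⟶ X` is a morphism over `ℂ`. -/
def IsPointOver {R : CommRingCat.{0}} [Algebra ℂ R] (g : Spec R ⟶ X) : Prop :=
  (Scheme.ΓSpecIso (CommRingCat.of ℂ)).inv ≫ (g ≫ X ↘ SpecC).appTop ≫ (Scheme.ΓSpecIso R).hom =
    CommRingCat.ofHom (algebraMap ℂ R)

/-- Evaluation of functions at a point with values in a `ℂ`-algebra. -/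
def evalHom {R : CommRingCat.{0}} [Algebra ℂ R] {g : Spec R ⟶ X} (hg : IsPointOver g) {U : X.Opens}
    (hU : ⊤ ≤ g ⁻¹ᵁ U) : Γ(X, U) →ₐ[ℂ] R where
  toRingHom := (g.appLE U ⊤ hU ≫ (Scheme.ΓSpecIso R).hom).hom
  commutes' r := by
    have e : (X ↘ SpecC).appLE ⊤ U (le_preimage_top _ U) ≫ g.appLE U ⊤ hU =
        (g ≫ X ↘ SpecC).appTop := by
      rw [Scheme.Hom.appLE_comp_appLE]
      exact appLE_top _ _
    have h := ConcreteCategory.congr_hom hg r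
    rw [← e] at h
    exact h

lemma evalHom_restrict {R : CommRingCat.{0}} [Algebra ℂ R] {g : Spec R ⟶ X} (hg : IsPointOver g)
    {U V : X.Opens} (hV : ⊤ ≤ g ⁻¹ᵁ V) (h : V ≤ U) :
    (evalHom hg hV).comp (restrictHom X h) =
      evalHom hg (hV.trans (fun _ hx => h hx)) := by
  ext r
  refine congrArg (Scheme.ΓSpecIso R).hom ?_
  exact ConcreteCategory.congr_hom (g.map_appLE hV (homOfLE h).op) r

lemma evalHom_pullback {R : CommRingCat.{0}} [Algebra ℂ R] {g : Spec R ⟶ Y} (hg : IsPointOver g)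
    {g' : Spec R ⟶ X} (hg' : IsPointOver g') (e : g ≫ π = g') {U : X.Opens} {V : Y.Opens}
    (hV : ⊤ ≤ g ⁻¹ᵁ V) (h : V ≤ π ⁻¹ᵁ U) (hU : ⊤ ≤ g' ⁻¹ᵁ U) :
    (evalHom hg hV).comp (pullbackHom π h) = evalHom hg' hU := by
  subst e
  ext r
  refine congrArg (Scheme.ΓSpecIso R).hom ?_
  exact ConcreteCategory.congr_hom (Scheme.Hom.appLE_comp_appLE g π U V ⊤ h hV) r

lemma evalHom_specMap {R S : CommRingCat.{0}} [Algebra ℂ R] [Algebra ℂ S] (φ : R →ₐ[ℂ] S)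
    {g : Spec R ⟶ X} (hg : IsPointOver g) {g' : Spec S ⟶ X} (hg' : IsPointOver g')
    (e : Spec.map (CommRingCat.ofHom φ.toRingHom) ≫ g = g') {U : X.Opens}
    (hU : ⊤ ≤ g ⁻¹ᵁ U) (hU' : ⊤ ≤ g' ⁻¹ᵁ U) :
    φ.comp (evalHom hg hU) = evalHom hg' hU' := by
  subst e
  have h : g.appLE U ⊤ hU ≫ (Scheme.ΓSpecIso R).hom ≫ CommRingCat.ofHom φ.toRingHom =
      (Spec.map (CommRingCat.ofHom φ.toRingHom) ≫ g).appLE U ⊤ hU' ≫ (Scheme.ΓSpecIso S).hom := by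
    rw [← Scheme.Hom.appLE_comp_appLE _ g U ⊤ ⊤ hU (le_preimage_top _ _), Category.assoc,
      appLE_top, ← Scheme.ΓSpecIso_naturality]
    rfl
  ext r
  exact ConcreteCategory.congr_hom h r

lemma isPointOver_fromSpecStalk (x : X) : IsPointOver (X.fromSpecStalk x) := by
  have h := fromSpecStalk_appLE x (U := ⊤) (Opens.mem_top x) (le_preimage_top _ _)
  rw [appLE_top] at h
  rw [IsPointOver, Scheme.Hom.comp_appTop, Category.assoc, h]
  rw [← appLE_top (X ↘ SpecC) (le_preimage_top _ _)]
  rfl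

lemma evalHom_fromSpecStalk (x : X) {U : X.Opens} (hx : x ∈ U)
    (hU : ⊤ ≤ (X.fromSpecStalk x) ⁻¹ᵁ U) :
    evalHom (isPointOver_fromSpecStalk x) hU = germHom U x hx := by
  ext r
  exact ConcreteCategory.congr_hom (fromSpecStalk_appLE x hx hU) r

end Morphisms

/-! ### Forms at the generic point and their Pfaffians. -/

section Generic

variable {X : Scheme.{0}} [X.Over SpecC] [IsVariety X]

section Forms

variable {U : X.Opens} {p : ℕ}

/-- The value of a differential form at the generic point. -/
def genForm (ω : DiffForm X U p) (hU : genericPoint X ∈ U) : AlgForm X.functionField p :=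
  AlgForm.map (germK _ (exists_affine_mem_le hU).choose_spec.1) p
    (ω.val _ (exists_affine_mem_le hU).choose_spec.2)

/-- The choice of affine open set in `genForm` is immaterial: any two such sets contain a common
smaller one around the generic point. -/
lemma map_germK_val (ω : DiffForm X U p) (hU : genericPoint X ∈ U) (V : X.affineOpens)
    (hV : V.1 ≤ U) (hg : genericPoint X ∈ V.1) :
    AlgForm.map (germK V.1 hg) p (ω.val V hV) = genForm ω hU := by
  have key : ∀ (V W : X.affineOpens) (hV : V.1 ≤ U) (hg : genericPoint X ∈ V.1) (h : W.1 ≤ V.1)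
      (hW : genericPoint X ∈ W.1), AlgForm.map (germK V.1 hg) p (ω.val V hV) =
        AlgForm.map (germK W.1 hW) p (ω.val W (h.trans hV)) := by
    intro V W hV hg h hW
    rw [← ω.map_val V W hV h, ← form_map_comp, germK_restrict]
  obtain ⟨h1, h2⟩ := (exists_affine_mem_le hU).choose_spec
  obtain ⟨W, hW, hle⟩ := exists_affine_mem_le (U := V.1 ⊓ (exists_affine_mem_le hU).choose.1)
    (x := genericPoint X) ⟨hg, h1⟩
  rw [genForm, key V W hV hg (hle.trans inf_le_left) hW,
    key _ W h2 h1 (hle.trans inf_le_right) hW]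

lemma map_toFunctionField_germHom_val (ω : DiffForm X U p) (hU : genericPoint X ∈ U)
    (V : X.affineOpens) (hV : V.1 ≤ U) {x : X} (hx : x ∈ V.1) :
    AlgForm.map (toFunctionField X x) p (AlgForm.map (germHom V.1 x hx) p (ω.val V hV)) =
      genForm ω hU := by
  rw [← form_map_comp, toFunctionField_comp_germHom, map_germK_val]

end Forms

lemma DiffForm.IsSymplectic.exists_stalk {ω : DiffForm X (regLocus X) 2} (hω : ω.IsSymplectic)
    {x : X} (hx : x ∈ regLocus X) : ∃ w : AlgForm (X.presheaf.stalk x) 2,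
      AlgForm.map (toFunctionField X x) 2 w = genForm ω genericPoint_mem_regLocus ∧
        w.IsNondegenerate := by
  obtain ⟨V, hxV, hV⟩ := exists_affine_mem_le hx
  exact ⟨_, map_toFunctionField_germHom_val ω _ V hV hxV,
    (germHom_isLoc V.2 x hxV).isNondegenerate (hasDual_sections V hV) (hω V hV).2⟩

lemma DiffForm.IsSymplectic.genForm {ω : DiffForm X (regLocus X) 2} (hω : ω.IsSymplectic) :
    (genForm ω genericPoint_mem_regLocus).IsClosed ∧
      (genForm ω genericPoint_mem_regLocus).IsNondegenerate := by
  obtain ⟨V, hxV, hV⟩ := exists_affine_mem_le (genericPoint_mem_regLocus (X := X))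
  have h1 := hasDual_sections V hV
  rw [← map_germK_val ω _ V hV hxV]
  exact ⟨(germK_isLoc V.2 hxV).isClosed h1 (hω V hV).1,
    (germK_isLoc V.2 hxV).isNondegenerate h1 (hω V hV).2⟩

lemma nonempty_basis_functionField (X : Scheme.{0}) [X.Over SpecC] [IsVariety X] :
    Nonempty (Module.Basis (Fin (Module.finrank X.functionField Ω[X.functionField⁄ℂ]))
      X.functionField Ω[X.functionField⁄ℂ]) :=
  HasDual.exists_basis (hasDual_stalk genericPoint_mem_regLocus)
    (IsLoc.of_bijective (φ := AlgHom.id ℂ X.functionField) Function.bijective_id)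

lemma exists_isPfaffian_functionField (ω : AlgForm X.functionField 2) :
    ∃ η : RatTopForm X, IsPfaffian η ω :=
  exists_isPfaffian (nonempty_basis_functionField X).some ω

lemma IsPfaffian.ne_zero {ω : AlgForm X.functionField 2} (hω : ω.IsNondegenerate)
    {η : RatTopForm X} (hη : IsPfaffian η ω) : η ≠ 0 := by
  rintro rfl
  obtain ⟨b⟩ := nonempty_basis_functionField X
  have h := ((isNondegenerate_iff_isUnit_det b ω).mp hω).ne_zero
  rw [hη b, map_zero] at h
  exact h (zero_pow two_ne_zero)

lemma exists_smul_eq_top {η : RatTopForm X} (hη : η ≠ 0) (θ : RatTopForm X) :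
    ∃ g : X.functionField, θ = g • η := by
  obtain ⟨b⟩ := nonempty_basis_functionField X
  have h0 : topCoord b η ≠ 0 := fun h => hη (by rw [← topCoord_smul b η, h, zero_smul])
  refine ⟨topCoord b θ * (topCoord b η)⁻¹, ?_⟩
  nth_rewrite 1 [← topCoord_smul b θ]
  nth_rewrite 2 [← topCoord_smul b η]
  rw [smul_smul, mul_assoc, inv_mul_cancel₀ h0, mul_one]

/-- The coordinate of the Pfaffian is a square root of a regular function, hence integral over the
local ring; normality makes it regular. -/
lemma isNondegenerate_iff_generates_stalk (hX : IsNormalScheme X) {x : X} (hx : x ∈ regLocus X)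
    {ω : AlgForm X.functionField 2} {η : RatTopForm X} (hη : IsPfaffian η ω)
    {w : AlgForm (X.presheaf.stalk x) 2} (hw : AlgForm.map (toFunctionField X x) 2 w = ω) :
    w.IsNondegenerate ↔ Generates (toFunctionField X x) η := by
  have : IsIntegrallyClosed (X.presheaf.stalk x) := hX x
  obtain ⟨b⟩ := (hasDual_stalk hx).exists_basis (toFunctionField_isLoc x)
  refine isNondegenerate_iff_generates (toFunctionField_injective x) (toFunctionField_isLoc x)
    (fun t r h => ?_) b w (by rw [hw]; exact hη)
  have hi : IsIntegral (X.presheaf.stalk x) (t ^ 2) := by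
    rw [h]
    exact isIntegral_algebraMap (R := X.presheaf.stalk x) (A := X.functionField)
  obtain ⟨s, hs⟩ := IsIntegrallyClosed.exists_algebraMap_eq_of_isIntegral_pow two_pos hi
  exact ⟨s, hs.symm⟩

lemma isLocalEquation_iff (η : RatTopForm X) (f : X.functionField) (x : X) :
    IsLocalEquation η f x ↔ f ≠ 0 ∧ Generates (toFunctionField X x) (f⁻¹ • η) := by
  simp only [IsLocalEquation, Generates, smul_smul]

/-- A rational function that is a unit in codimension one near a point of a normal variety is
a unit at this point. -/
lemma exists_isUnit_toFunctionField (hX : IsNormalScheme X) (p : X) {f : X.functionField}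
    (hf : f ≠ 0) (h : ∀ x : X, Order.coheight x = 1 → x ⤳ p →
      ∃ u, IsUnit u ∧ toFunctionField X x u = f) :
    ∃ u, IsUnit u ∧ toFunctionField X p u = f := by
  obtain ⟨a, ha⟩ := mem_range_toFunctionField hX p f fun x hx hxp =>
    ⟨_, (h x hx hxp).choose_spec.2⟩
  obtain ⟨b, hb⟩ := mem_range_toFunctionField hX p f⁻¹ fun x hx hxp => by
    obtain ⟨u, hu, e⟩ := h x hx hxp
    refine ⟨↑hu.unit⁻¹, eq_inv_of_mul_eq_one_left ?_⟩
    rw [← e, ← map_mul, IsUnit.val_inv_mul, map_one]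
  refine ⟨a, IsUnit.of_mul_eq_one b (toFunctionField_injective p ?_), ha⟩
  rw [map_mul, ha, hb, mul_inv_cancel₀ hf, map_one]

end Generic

/-! ### Regularity in codimension one through the valuative criterion. -/

section Valuative

variable {X Y Z : Scheme.{0}} [X.Over SpecC] [Y.Over SpecC] [Z.Over SpecC] [IsVariety X]
  [IsVariety Y]

/-- A 2-form on an open subset of `X` that extends to a proper birational modification of `X` is
regular at all points of codimension one of every normal variety that dominates `X`. -/
lemma exists_stalk_of_extendsPullback {U : X.Opens} (hU : genericPoint X ∈ U) (ω : DiffForm X U 2)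
    (f : Z ⟶ X) [f.IsOver SpecC] [IsProper f] [IsBirational f] (ω' : DiffForm Z ⊤ 2)
    (hω : DiffForm.ExtendsPullback f ω ω') (π : Y ⟶ X) [π.IsOver SpecC] [IsDominant π]
    (hY : IsNormalScheme Y) {y : Y} (hy : Order.coheight y = 1) :
    ∃ w : AlgForm (Y.presheaf.stalk y) 2,
      AlgForm.map (toFunctionField Y y) 2 w = AlgForm.map (ffHom π) 2 (genForm ω hU) := by
  have hdvr := isDiscreteValuationRing_stalk hY hy
  obtain ⟨e, he⟩ := IsBirational.exists_partialIso (π := f)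
  have hT : genericPoint X ∈ e.target := mem_of_nonempty e.dense_target.nonempty
  have hTf : (e.iso.inv ≫ e.source.ι) ≫ f = e.target.ι := by
    rw [Category.assoc, ← he, Iso.inv_hom_id_assoc]
  let η := genericPoint Y
  have : Subsingleton (Spec Y.functionField) :=
    inferInstanceAs (Subsingleton (PrimeSpectrum Y.functionField))
  let s : Spec Y.functionField ⟶ X := Y.fromSpecStalk η ≫ π
  have hs : ∀ x, s x = genericPoint X := by
    intro x
    have hx : (Y.fromSpecStalk η) x = η := by
      have : x = IsLocalRing.closedPoint Y.functionField := Subsingleton.elim _ _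
      rw [this]
      exact Scheme.fromSpecStalk_closedPoint
    rw [Scheme.Hom.comp_apply, hx, map_genericPoint π]
  have hrange : Set.range s ⊆ Set.range e.target.ι := by
    rintro _ ⟨x, rfl⟩
    rw [hs, Scheme.Opens.range_ι]
    exact hT
  -- The generic point of `Y` maps to that of `X`, over which `f` is an isomorphism, so it lifts to
  -- `Z`.
  let i₁ : Spec Y.functionField ⟶ Z :=
    IsOpenImmersion.lift e.target.ι s hrange ≫ e.iso.inv ≫ e.source.ι
  have hi₁ : i₁ ≫ f = s := by
    rw [Category.assoc, hTf, IsOpenImmersion.lift_fac]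
  let φ : CommRingCat.of (Y.presheaf.stalk y) ⟶ Y.functionField :=
    CommRingCat.ofHom (toFunctionField Y y).toRingHom
  have hφ : Spec.map φ ≫ Y.fromSpecStalk y = Y.fromSpecStalk η :=
    Y.SpecMap_stalkSpecializes_fromSpecStalk ((genericPoint_spec Y).specializes trivial)
  have hsq : CommSq i₁ (Spec.map φ) f (Y.fromSpecStalk y ≫ π) :=
    ⟨by rw [hi₁, ← Category.assoc, hφ]⟩
  have hex : ValuativeCriterion.Existence f := by
    have : UniversallyClosed f := inferInstance
    rw [UniversallyClosed.eq_valuativeCriterion] at this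
    exact this.1
  have hdom : IsDomain (Y.presheaf.stalk y) := inferInstance
  have hval : ValuationRing (Y.presheaf.stalk y) := inferInstance
  obtain ⟨⟨l, hl₁, hl₂⟩⟩ := (hex
    { R := Y.presheaf.stalk y, commRing := (Y.presheaf.stalk y).commRing, domain := hdom,
      valuationRing := hval, K := Y.functionField, field := inferInstance,
      algebra := inferInstance, isFractionRing := inferInstance, i₁ := i₁, i₂ := Y.fromSpecStalk y ≫ π,
      commSq := hsq }).exists_lift
  change Spec.map φ ≫ l = i₁ at hl₁
  have hover : ∀ {R : CommRingCat.{0}} [Algebra ℂ R] (g : Spec R ⟶ Z) (g' : Spec R ⟶ Y),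
      g ≫ f = g' ≫ π → IsPointOver g' → IsPointOver g := by
    intro R _ g g' h hg'
    rw [IsPointOver, ← hg', ← comp_over f SpecC, ← comp_over π SpecC, reassoc_of% h]
  have hpl : IsPointOver l := hover l _ hl₂ (isPointOver_fromSpecStalk y)
  have hpi : IsPointOver i₁ := hover i₁ _ hi₁ (isPointOver_fromSpecStalk η)
  have hps : IsPointOver s := by
    rw [IsPointOver, Category.assoc, comp_over π SpecC]
    exact isPointOver_fromSpecStalk η
  obtain ⟨_, ⟨W, hW, rfl⟩, hzW, -⟩ := Z.isBasis_affineOpens.exists_subset_of_mem_open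
    (Set.mem_univ (l (IsLocalRing.closedPoint (Y.presheaf.stalk y)))) isOpen_univ
  -- Every point of the spectrum of a local ring specializes to the closed point, so `l` factors
  -- through any neighbourhood of the image of that point.
  have hlW : ⊤ ≤ l ⁻¹ᵁ W := fun x _ =>
    ((IsLocalRing.specializes_closedPoint x).map l.continuous).mem_open W.isOpen hzW
  obtain ⟨V, hgV, hV⟩ := exists_affine_mem_le hU
  let pt : Spec Y.functionField := IsLocalRing.closedPoint Y.functionField
  have hptW : i₁ pt ∈ W := by
    rw [← hl₁]
    exact hlW (Opens.mem_top (Spec.map φ pt))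
  have hptV : i₁ pt ∈ f ⁻¹ᵁ V.1 := by
    change f (i₁ pt) ∈ V.1
    rw [← Scheme.Hom.comp_apply, hi₁, hs]
    exact hgV
  -- On `W'` the form `ω'` can be compared with `f^*ω`; only the generic point of the valuation ring
  -- has to land there.
  obtain ⟨W', hptW', hW'⟩ := exists_affine_mem_le (U := W ⊓ f ⁻¹ᵁ V.1) ⟨hptW, hptV⟩
  have hiW' : ⊤ ≤ i₁ ⁻¹ᵁ W'.1 := fun x _ => by
    have : x = pt := Subsingleton.elim _ _
    rw [this]
    exact hptW'
  have hsV : ⊤ ≤ s ⁻¹ᵁ V.1 := fun x _ => by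
    change s x ∈ V.1
    rw [hs]
    exact hgV
  refine ⟨AlgForm.map (evalHom hpl hlW) 2 (ω'.val ⟨W, hW⟩ le_top), ?_⟩
  have hiW : ⊤ ≤ i₁ ⁻¹ᵁ W := hiW'.trans fun x hx => (hW' hx).1
  rw [← form_map_comp, evalHom_specMap (R := CommRingCat.of (Y.presheaf.stalk y))
    (toFunctionField Y y) hpl hpi hl₁ hlW hiW,
    ← evalHom_restrict hpi hiW' (hW'.trans inf_le_left), form_map_comp,
    ω'.map_val ⟨W, hW⟩ W' le_top (hW'.trans inf_le_left),
    ← hω V W' hV le_top (hW'.trans inf_le_right), ← form_map_comp,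
    evalHom_pullback f hpi hps hi₁ hiW' (hW'.trans inf_le_right) hsV,
    ← map_germK_val ω hU V hV hgV, ← form_map_comp]
  have hgY : genericPoint Y ∈ π ⁻¹ᵁ V.1 := by
    change π (genericPoint Y) ∈ V.1
    rw [map_genericPoint π]
    exact hgV
  have hgY' : ⊤ ≤ (Y.fromSpecStalk η) ⁻¹ᵁ (π ⁻¹ᵁ V.1) := hsV
  rw [ffHom_comp_germK π le_rfl hgV hgY, germK,
    ← evalHom_fromSpecStalk (genericPoint Y) hgY hgY',
    evalHom_pullback π (isPointOver_fromSpecStalk η) hps rfl hgY' le_rfl hsV]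

end Valuative

/-! ### Extension of symplectic forms over the smooth locus. -/

section Extension

variable {X : Scheme.{0}} [X.Over SpecC] [IsVariety X]

lemma subsingleton_sections {U : X.Opens} (h : genericPoint X ∉ U) : Subsingleton Γ(X, U) := by
  have hU : U = ⊥ := by
    by_contra hne
    exact h (mem_of_nonempty ((Opens.ne_bot_iff_nonempty U).mp hne))
  subst hU
  infer_instance

lemma subsingleton_algForm {A : Type} [CommRing A] [Algebra ℂ A] [Subsingleton A] (p : ℕ) :
    Subsingleton (AlgForm A p) :=
  Module.subsingleton A _

/-- A symplectic form on the function field of a normal variety that is regular and nondegenerate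
in codimension one is a symplectic form on the smooth locus. -/
lemma exists_isSymplectic_of_forall (hX : IsNormalScheme X) {ω : AlgForm X.functionField 2}
    (hc : ω.IsClosed) (hn : ω.IsNondegenerate)
    (h : ∀ x : X, Order.coheight x = 1 → ∃ w : AlgForm (X.presheaf.stalk x) 2,
      AlgForm.map (toFunctionField X x) 2 w = ω ∧ w.IsNondegenerate) :
    ∃ ω' : DiffForm X (regLocus X) 2, ω'.IsSymplectic ∧
      ∀ (V : X.affineOpens) (hV : V.1 ≤ regLocus X) (hg : genericPoint X ∈ V.1),
        AlgForm.map (germK V.1 hg) 2 (ω'.val V hV) = ω := by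
  have key : ∀ (V : X.affineOpens) (_ : V.1 ≤ regLocus X), ∃ w : AlgForm Γ(X, V.1) 2,
      w.IsClosed ∧ w.IsNondegenerate ∧
        ∀ hg : genericPoint X ∈ V.1, AlgForm.map (germK V.1 hg) 2 w = ω := by
    intro V hV
    by_cases hg : genericPoint X ∈ V.1
    · obtain ⟨w, hw, hwn⟩ := exists_nondegenerate_of_forall (germK_injective V.1 hg)
        (germK_isLoc V.2 hg) (hasDual_sections V hV)
        (I := {x : X // x ∈ V.1 ∧ Order.coheight x = 1})
        (R := fun x => X.presheaf.stalk x.1)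
        (fun x => germHom V.1 x.1 x.2.1) (fun x => toFunctionField X x.1)
        (fun x => toFunctionField_comp_germHom V.1 x.1 x.2.1)
        (fun x => germHom_isLoc V.2 x.1 x.2.1) (fun x => toFunctionField_isLoc x.1)
        (fun f hf => mem_range_germK hX V hg f fun x hx hx1 => hf ⟨x, hx, hx1⟩) hn
        (fun x => h x.1 x.2.2)
      exact ⟨w, (germK_isLoc V.2 hg).isClosed_of_map (germK_injective V.1 hg) (hw ▸ hc), hwn,
        fun _ => hw⟩
    -- Here `V` is empty and its ring of functions is zero.
    · have := subsingleton_sections hg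
      exact ⟨0, fun _ _ _ => Subsingleton.elim _ _,
        fun l => ⟨0, fun _ => Subsingleton.elim _ _,
          fun _ _ => Derivation.ext fun _ => Subsingleton.elim _ _⟩,
        fun hg' => absurd hg' hg⟩
  choose v hvc hvn hv using key
  refine ⟨⟨v, fun V W hV hWV => ?_⟩, fun V hV => ⟨hvc V hV, hvn V hV⟩, fun V hV hg => hv V hV hg⟩
  by_cases hg : genericPoint X ∈ W.1
  · refine (germK_isLoc W.2 hg).form_map_injective (hasDual_sections W (hWV.trans hV))
      (germK_injective W.1 hg) ?_
    rw [← form_map_comp, germK_restrict, hv, hv]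
  · have := subsingleton_sections hg
    have := subsingleton_algForm (A := Γ(X, W.1)) 2
    exact Subsingleton.elim _ _

lemma DiffForm.IsSymplectic.generates (hX : IsNormalScheme X) {ω : DiffForm X (regLocus X) 2}
    (hω : ω.IsSymplectic) {η : RatTopForm X}
    (hη : IsPfaffian η (SymplecticGeometry.genForm ω genericPoint_mem_regLocus)) {x : X}
    (hx : Order.coheight x = 1) : Generates (toFunctionField X x) η := by
  have hr := mem_regLocus_of_coheight_eq_one hX hx
  obtain ⟨w, hw, hwn⟩ := hω.exists_stalk hr
  exact (isNondegenerate_iff_generates_stalk hX hr hη hw).mp hwn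

end Extension

/-! ### The two implications. -/

section PartialResolution

variable {X Y : Scheme.{0}} [X.Over SpecC] [Y.Over SpecC] [IsVariety X] [IsVariety Y]
  {π : Y ⟶ X} [π.IsOver SpecC] [IsPartialResolution π] {ω : DiffForm X (regLocus X) 2}

/-- The Pfaffians of the two symplectic forms have trivial divisors, so `f = 1` serves as local
equation at every point. -/
lemma IsSymplecticPartialResolution.isCrepant (hω : ω.IsSymplectic)
    (h : IsSymplecticPartialResolution π ω) : IsCrepant π := by
  obtain ⟨ω', -, hω'⟩ := h
  obtain ⟨η, hη⟩ := exists_isPfaffian_functionField (genForm ω genericPoint_mem_regLocus)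
  obtain ⟨η', hη'⟩ := exists_isPfaffian_functionField (genForm ω' genericPoint_mem_regLocus)
  refine ⟨η, η', hη.ne_zero hω.genForm.2, hη'.ne_zero hω'.genForm.2,
    fun p => ⟨1, one_ne_zero, fun x hx _ => ?_, fun y hy _ => ?_⟩⟩
  · rw [isLocalEquation_iff, inv_one, one_smul]
    exact ⟨one_ne_zero, hω.generates (IsPartialResolution.normal_target π) hη hx⟩
  · rw [isLocalEquation_iff, map_one, inv_one, one_smul]
    exact ⟨one_ne_zero, hω'.generates (IsPartialResolution.normal_source π) hη' hy⟩

/-- If `π` is crepant, then a canonical divisor of `X` that is trivial in codimension one pulls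
back to a canonical divisor of `Y` that is trivial in codimension one. -/
lemma IsCrepant.exists_generates (h : IsCrepant π) {η₀ : RatTopForm X} (h₀ : η₀ ≠ 0)
    (hη₀ : ∀ x : X, Order.coheight x = 1 → Generates (toFunctionField X x) η₀) :
    ∃ η' : RatTopForm Y, η' ≠ 0 ∧
      ∀ y : Y, Order.coheight y = 1 → Generates (toFunctionField Y y) η' := by
  obtain ⟨η, η', hη, hη', h⟩ := h
  obtain ⟨g, rfl⟩ := exists_smul_eq_top hη η₀
  have hg : g ≠ 0 := by
    rintro rfl
    exact h₀ (zero_smul _ _)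
  refine ⟨ffHom π g • η', ?_, fun y hy => ?_⟩
  · intro e
    refine hη' ?_
    rw [← one_smul Y.functionField η', ← inv_mul_cancel₀ ((map_ne_zero (ffHom π)).mpr hg),
      ← smul_smul, e, smul_zero]
  · obtain ⟨f, hf, hfX, hfY⟩ := h (π y)
    have hfη : f⁻¹ • η ≠ 0 := by
      intro e
      refine hη ?_
      rw [← one_smul X.functionField η, ← mul_inv_cancel₀ hf, ← smul_smul, e, smul_zero]
    -- Both `f⁻¹ • η` and `g • η = (g * f) • f⁻¹ • η` generate in codimension one near `π y`. Thus
    -- `g * f` is a unit there, and at `π y` itself by normality.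
    obtain ⟨u, hu, e⟩ := exists_isUnit_toFunctionField (IsPartialResolution.normal_target π) (π y)
      (mul_ne_zero hg hf) fun x hx hxp =>
        ((isLocalEquation_iff _ _ _).mp (hfX x hx hxp)).2.exists_unit
          (toFunctionField_injective x) hfη (by
            rw [smul_smul, mul_assoc, mul_inv_cancel₀ hf, mul_one]
            exact hη₀ x hx)
    have h1 := ((isLocalEquation_iff _ _ _).mp (hfY y hy rfl)).2.smul_unit (hu.map (stalkHom π y))
    have h2 : toFunctionField Y y (stalkHom π y u) = ffHom π g * ffHom π f := by
      rw [← map_mul, ← e]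
      exact (DFunLike.congr_fun (ffHom_comp_toFunctionField π y) u).symm
    rw [h2, smul_smul, mul_assoc] at h1
    rwa [show ffHom π f * (functionFieldMap π f)⁻¹ = 1 from
      mul_inv_cancel₀ ((map_ne_zero (ffHom π)).mpr hf), mul_one] at h1

/-- Over `X_reg` the local rings at `y` and `π y` are isomorphic, and coheight is the Krull
dimension of the local ring. -/
lemma coheight_eq_one_of_apply (y : Y) (hy : π y ∈ regLocus X)
    (h : Order.coheight (π y) = 1) : Order.coheight y = 1 := by
  have := IsPartialResolution.isIso_regLocus (π := π)
  have e := ringKrullDim_eq_of_ringEquiv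
    (RingEquiv.ofBijective (stalkHom π y) (stalkHom_bijective π (regLocus X) y hy))
  rw [ringKrullDim_stalk_eq_coheight, ringKrullDim_stalk_eq_coheight, h] at e
  exact_mod_cast e.symm

lemma IsCrepant.isSymplecticPartialResolution (hω : IsSymplecticSingularity X ω)
    (h : IsCrepant π) : IsSymplecticPartialResolution π ω := by
  have hX := hω.normal
  have hY := IsPartialResolution.normal_source π
  have := IsPartialResolution.isIso_regLocus (π := π)
  have hbij := ffHom_bijective π (regLocus X) genericPoint_mem_regLocus
  have hdual : HasDual X.functionField := hasDual_stalk genericPoint_mem_regLocus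
  obtain ⟨hcX, hnX⟩ := hω.symplectic.genForm
  obtain ⟨η₀, hη₀⟩ := exists_isPfaffian_functionField (genForm ω genericPoint_mem_regLocus)
  obtain ⟨η', hη', hgen⟩ := h.exists_generates (hη₀.ne_zero hnX)
    fun x hx => hω.symplectic.generates hX hη₀ hx
  let ωY := AlgForm.map (ffHom π) 2 (genForm ω genericPoint_mem_regLocus)
  have hcY : ωY.IsClosed := (IsLoc.of_bijective hbij).isClosed hdual hcX
  have hnY : ωY.IsNondegenerate := (IsLoc.of_bijective hbij).isNondegenerate hdual hnX
  obtain ⟨ηY, hηY⟩ := exists_isPfaffian_functionField ωY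
  obtain ⟨g, rfl⟩ := exists_smul_eq_top hη' ηY
  have hg : g ≠ 0 := by
    rintro rfl
    exact hηY.ne_zero hnY (zero_smul _ _)
  -- The comparison factor between the two top forms on `Y` descends to `X`, where normality can be
  -- used.
  obtain ⟨k, rfl⟩ := hbij.2 g
  have hk : k ≠ 0 := fun hk => hg (by rw [hk, map_zero])
  -- A codimension-one point of `X` lies in `X_reg` and comes from a codimension-one point of `Y`,
  -- where the Pfaffian of the transported form and `η'` both generate.
  have hunit : ∀ x : X, Order.coheight x = 1 → ∃ u, IsUnit u ∧ toFunctionField X x u = k := by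
    intro x hx
    have hxr := mem_regLocus_of_coheight_eq_one hX hx
    obtain ⟨y, rfl⟩ := exists_apply_eq π (regLocus X) x hxr
    have hy := coheight_eq_one_of_apply y hxr hx
    have hyb := stalkHom_bijective π (regLocus X) y hxr
    obtain ⟨w, hw, hwn⟩ := hω.symplectic.exists_stalk hxr
    have h1 : (AlgForm.map (stalkHom π y) 2 w).IsNondegenerate :=
      (IsLoc.of_bijective hyb).isNondegenerate (hasDual_stalk hxr) hwn
    have h2 : AlgForm.map (toFunctionField Y y) 2 (AlgForm.map (stalkHom π y) 2 w) = ωY := by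
      rw [← form_map_comp, ← ffHom_comp_toFunctionField, form_map_comp, hw]
    have h3 := (isNondegenerate_iff_generates_stalk hY (mem_regLocus_of_coheight_eq_one hY hy)
      hηY h2).mp h1
    obtain ⟨v, hv, e⟩ := (hgen y hy).exists_unit (toFunctionField_injective y) hη' h3
    obtain ⟨u, rfl⟩ := hyb.2 v
    refine ⟨u, ?_, hbij.1 (Eq.trans ?_ e)⟩
    · exact (isUnit_map_iff (RingEquiv.ofBijective (stalkHom π y) hyb) u).mp hv
    · exact DFunLike.congr_fun (ffHom_comp_toFunctionField π y) u
  have hstalk : ∀ y : Y, Order.coheight y = 1 → ∃ w : AlgForm (Y.presheaf.stalk y) 2,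
      AlgForm.map (toFunctionField Y y) 2 w = ωY ∧ w.IsNondegenerate := by
    intro y hy
    obtain ⟨Z, _, f, _, ω', hf, hext⟩ := hω.extends_resolution
    have := hf.proper
    have := hf.birational
    obtain ⟨w, hw⟩ := exists_stalk_of_extendsPullback genericPoint_mem_regLocus ω f ω' hext π hY hy
    refine ⟨w, hw, (isNondegenerate_iff_generates_stalk hY
      (mem_regLocus_of_coheight_eq_one hY hy) hηY hw).mpr ?_⟩
    -- The point `π y` may be singular and of higher codimension; normality of `X` still makes `k` a
    -- unit there, so its pullback is a unit at `y`.
    obtain ⟨u, hu, e⟩ := exists_isUnit_toFunctionField hX (π y) hk fun x hx _ => hunit x hx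
    have h2 : toFunctionField Y y (stalkHom π y u) = ffHom π k := by
      rw [← e]
      exact (DFunLike.congr_fun (ffHom_comp_toFunctionField π y) u).symm
    rw [← h2]
    exact (hgen y hy).smul_unit (hu.map (stalkHom π y))
  obtain ⟨ω', hs, hω'⟩ := exists_isSymplectic_of_forall hY hcY hnY hstalk
  refine ⟨ω', fun V W hV hW hVW => ?_, hs⟩
  by_cases hg : genericPoint Y ∈ W.1
  · have hgX : genericPoint X ∈ V.1 := by
      rw [← map_genericPoint π]
      exact hVW hg
    -- Forms on a smooth affine open set embed into forms at the generic point, where both sides are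
    -- the pullback of `ω`.
    refine (germK_isLoc W.2 hg).form_map_injective (hasDual_sections W hW)
      (germK_injective W.1 hg) ?_
    rw [← form_map_comp, ← ffHom_comp_germK π hVW hgX hg, form_map_comp, hω' W hW hg,
      map_germK_val ω genericPoint_mem_regLocus]
  · have := subsingleton_sections hg
    have := subsingleton_algForm (A := Γ(Y, W.1)) 2
    exact Subsingleton.elim _ _

end PartialResolution

end SymplecticGeometry

end

theorem mainTheorem10 (X Y : AlgebraicGeometry.Scheme.{0})
    [X.Over SymplecticGeometry.SpecC] [Y.Over SymplecticGeometry.SpecC]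
    [SymplecticGeometry.IsVariety X] [SymplecticGeometry.IsVariety Y]
    (ω : SymplecticGeometry.DiffForm X (SymplecticGeometry.regLocus X) 2)
    (hω : SymplecticGeometry.IsSymplecticSingularity X ω)
    (π : Y ⟶ X) [π.IsOver SymplecticGeometry.SpecC]
    [SymplecticGeometry.IsPartialResolution π] :
    SymplecticGeometry.IsSymplecticPartialResolution π ω ↔ SymplecticGeometry.IsCrepant π := by
  exact ⟨fun h => h.isCrepant hω.symplectic, fun h => h.isSymplecticPartialResolution hω⟩
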